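/- Let $\zeta$ be the Riemann zeta-function and $\gamma$ Euler's constant. For every complex $\delta$ with $\operatorname{Re}\delta>0$ the integrals $$\int_0^\infty |\zeta(\tfrac12+it)|^2e^{-\delta t}\,dt\qquad\text{and}\qquad\int_0^\infty\Bigl(2\gamma+\log\frac{t}{2\pi}\Bigr)e^{-\delta t}\,dt$$ converge absolutely, and for every $\eta>0$ $$\lim_{\delta\to0}\left(\int_0^\infty |\zeta(\tfrac12+it)|^2e^{-\delta t}\,dt-\int_0^\infty\Bigl(2\gamma+\log\frac{t}{2\pi}\Bigr)e^{-\delta t}\,dt\right)=\pi,$$ where $\delta$ tends to $0$ through the nonzero complex numbers with $|\arg\delta|\le\frac{\pi}{2}-\eta$. (In particular the limit holds as $\delta\to0^+$ through real numbers.) -/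

import Mathlib

namespace ZetaMeanSquare

open Complex MeasureTheory Set Filter Topology Asymptotics

open scoped ComplexConjugate

/-! The mean square is read off from the Lambert series `L(z) = ∑ 1/(exp (n z) - 1)`, whose Mellin
transform along the ray through `z` is `Γ(s) ζ(s)² z^(-s)` for `Re s > 1`. Removing the leading term
`(γ - log z)/z` at `0` leaves `lambertRem`, which has the same transform in the strip `0 < Re s < 1`
(`hasMellin_lambertRem`). Mellin inversion on the critical line then gives `∫ Γ ζ² z^(-s) dt = 2π
lambertRem z` (`integral_gammaZetaSq_mul_cpow`).

Take `z = 2πi exp(-iδ)`. On the critical line `1 - s` is the conjugate of `s`, so the functional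
equation turns the integrand, up to the factor `exp(-iδ/2)`, into `|ζ|² exp(-δt) / (1 + i exp(-πt))`
(`integral_rotated`). Averaging with the conjugate integral at `conj δ` replaces the denominator by
`1 + exp(-2πt)`. Since `|ζ|²` is even in `t`, the result is the one-sided integral plus a correction
that vanishes with `δ` (`symmetrized_rotatedMean`, `tendsto_fermiCorrection`).

It remains to evaluate `lambertRem` at `2πi exp(-iδ)`. As `L` has period `2πi`, its value there
equals its value at `2πi (exp(-iδ) - 1)`, which is close to `2πδ`. The trapezoidal rule gives
`lambertRem → 1/4` at `0` inside sectors (`tendsto_lambertRem`). The leading term of `L` reproduces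
the Laplace transform of `2γ + log(t/2π)` up to a negligible error. The real constant is `π/2` from
`2π · 1/4` and `π/2` from `log i` in the leading term at `2πi`; the imaginary constant disappears in
the averaging. -/

/-! ### Mellin transforms of exponentials and of sums over dilations -/

lemma mellinConvergent_exp_neg_mul {z s : ℂ} (hz : 0 < z.re) (hs : 0 < s.re) :
    MellinConvergent (fun x : ℝ => exp (-(z * x))) s := by
  refine mellinConvergent_of_isBigO_rpow_exp (b := 0) hz ?_ ?_ ?_ hs
  · exact (by fun_prop : Continuous fun x : ℝ => exp (-(z * x))).continuousOn.locallyIntegrableOn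
      measurableSet_Ioi
  · refine IsBigO.of_norm_le fun x => ?_
    simp [Complex.norm_exp]
  · simp only [neg_zero, Real.rpow_zero]
    refine (Continuous.tendsto (by fun_prop : Continuous fun x : ℝ => exp (-(z * x))) 0).isBigO_one
      (F := ℝ) |>.mono nhdsWithin_le_nhds

lemma differentiableAt_mellin_exp_neg_mul {s z : ℂ} (hz : 0 < z.re) (hs : 0 < s.re) :
    DifferentiableAt ℂ (fun w : ℂ => mellin (fun x : ℝ => exp (-(w * x))) s) z := by
  have hr : 0 < z.re / 2 := by positivity
  have meas (w a : ℂ) : AEStronglyMeasurable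
      (fun x : ℝ => (x : ℂ) ^ a * exp (-(w * x))) (volume.restrict (Ioi 0)) := by
    refine ContinuousOn.aestronglyMeasurable (fun x hx => ?_) measurableSet_Ioi
    refine ContinuousAt.continuousWithinAt (ContinuousAt.mul ?_ (by fun_prop))
    exact continuousAt_ofReal_cpow_const _ _ (Or.inr hx.ne')
  refine (hasDerivAt_integral_of_dominated_loc_of_deriv_le
    (F := fun (w : ℂ) (x : ℝ) => (x : ℂ) ^ (s - 1) • exp (-(w * x)))
    (F' := fun (w : ℂ) (x : ℝ) => (x : ℂ) ^ (s - 1) * (exp (-(w * x)) * (-x)))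
    (bound := fun x : ℝ => ‖(x : ℂ) ^ (s + 1 - 1) • exp (-(((z.re / 2 : ℝ) : ℂ) * x))‖)
    (Metric.ball_mem_nhds z hr) ?_ ?_ ?_ ?_ ?_ ?_).2.differentiableAt
  · exact Eventually.of_forall fun w => meas w _
  · exact mellinConvergent_exp_neg_mul hz hs
  · have := (meas z (s - 1)).mul
      ((by fun_prop : Continuous fun x : ℝ => (-x : ℂ)).aestronglyMeasurable)
    refine this.congr (Eventually.of_forall fun x => ?_)
    simp [mul_assoc]
  · refine (ae_restrict_iff' measurableSet_Ioi).mpr (Eventually.of_forall fun x hx w hw => ?_)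
    have hx0 : (x : ℂ) ≠ 0 := by exact_mod_cast hx.ne'
    have hw' : z.re / 2 ≤ w.re := by
      have := (abs_re_le_norm (w - z)).trans (mem_ball_iff_norm.mp hw).le
      rw [sub_re, abs_le] at this
      linarith
    rw [add_sub_right_comm, cpow_add _ _ hx0, cpow_one, norm_mul, norm_mul, norm_smul, norm_mul,
      norm_neg, mul_assoc, mul_comm ‖exp _‖]
    gcongr
    rw [Complex.norm_exp, Complex.norm_exp]
    simp only [neg_re, re_mul_ofReal, ofReal_re]
    gcongr
    exact le_of_lt hx
  · exact (mellinConvergent_exp_neg_mul (s := s + 1) (by simpa using hr)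
      (by simp; positivity)).norm
  · refine Eventually.of_forall fun x w _ => ?_
    have h : HasDerivAt (fun w : ℂ => -(w * x)) (-(1 * (x : ℂ))) w :=
      ((hasDerivAt_id w).mul_const _).neg
    simpa using! (h.cexp.const_mul ((x : ℂ) ^ (s - 1)))

/-- Both sides are holomorphic in `z` on the right half plane and agree for positive real `z` by
Euler's integral, so the identity theorem applies. -/
lemma mellin_exp_neg_mul {z s : ℂ} (hz : 0 < z.re) (hs : 0 < s.re) :
    mellin (fun x : ℝ => exp (-(z * x))) s = Gamma s * z ^ (-s) := by
  have hopen : IsOpen {w : ℂ | 0 < w.re} := isOpen_lt continuous_const continuous_re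
  have hl : AnalyticOnNhd ℂ (fun w : ℂ => mellin (fun x : ℝ => exp (-(w * x))) s)
      {w : ℂ | 0 < w.re} := DifferentiableOn.analyticOnNhd
    (fun w hw => (differentiableAt_mellin_exp_neg_mul hw hs).differentiableWithinAt) hopen
  have hr : AnalyticOnNhd ℂ (fun w : ℂ => Gamma s * w ^ (-s)) {w : ℂ | 0 < w.re} := by
    refine DifferentiableOn.analyticOnNhd (fun w hw => ?_) hopen
    refine DifferentiableAt.differentiableWithinAt (DifferentiableAt.const_mul ?_ _)
    exact (differentiableAt_id).cpow_const (Or.inl hw)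
  refine hl.eqOn_of_preconnected_of_frequently_eq hr
    (convex_halfSpace_re_gt 0).isPreconnected (z₀ := 1) (by simp) ?_ hz
  -- Positive reals accumulating at `1` without reaching it: enough points for the identity theorem.
  have hu : Tendsto (fun n : ℕ => ((1 + 1 / ((n : ℝ) + 1) : ℝ) : ℂ)) atTop (𝓝[≠] 1) := by
    refine tendsto_nhdsWithin_iff.mpr ⟨?_, Eventually.of_forall fun n => ?_⟩
    · have := (continuous_ofReal.tendsto ((1 : ℝ) + 0)).comp
        (tendsto_const_nhds.add (tendsto_one_div_add_atTop_nhds_zero_nat (𝕜 := ℝ)))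
      rw [add_zero, ofReal_one] at this
      exact this
    · have : (0 : ℝ) < 1 / ((n : ℝ) + 1) := by positivity
      simp only [mem_compl_iff, mem_singleton_iff]
      rw [ofReal_eq_one]
      linarith
  refine hu.frequently (Frequently.of_forall fun n => ?_)
  have hpos : 0 < 1 + 1 / ((n : ℝ) + 1) := by positivity
  have := Complex.integral_cpow_mul_exp_neg_mul_Ioi hs hpos
  rw [mellin]
  simp only [smul_eq_mul]
  rw [this, one_div, inv_cpow _ _ (by rw [arg_ofReal_of_nonneg hpos.le]; exact Real.pi_pos.ne),
    cpow_neg, mul_comm]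

/-- Dilation by `n + 1` multiplies a Mellin transform by `(n + 1)^(-s)`. Sum and integral may be
exchanged because the `L¹` norms scale by `(n + 1)^(-Re s)`, which is summable. Applied twice to the
exponential, this yields `ζ²`. -/
lemma mellin_tsum_comp_mul {g : ℝ → ℂ} {s : ℂ} (hg : MellinConvergent g s) (hs : 1 < s.re) :
    mellin (fun x => ∑' n : ℕ, g ((n + 1) * x)) s = riemannZeta s * mellin g s := by
  have hpos (n : ℕ) : (0 : ℝ) < n + 1 := by positivity
  have hint (n : ℕ) : MellinConvergent (fun x => g ((n + 1) * x)) s :=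
    (MellinConvergent.comp_mul_left (hpos n)).mpr hg
  have hnorm (n : ℕ) : ∫ x in Ioi (0 : ℝ), ‖(x : ℂ) ^ (s - 1) • g ((n + 1) * x)‖ =
      ((n : ℝ) + 1) ^ (-s.re) * ∫ x in Ioi (0 : ℝ), x ^ (s.re - 1) * ‖g x‖ := by
    have h := mellin_comp_mul_left (fun x => ((‖g x‖ : ℝ) : ℂ)) (s.re : ℂ) (hpos n)
    have key (k : ℝ → ℝ) : mellin (fun x => (k x : ℂ)) (s.re : ℂ) =
        ((∫ x in Ioi (0 : ℝ), x ^ (s.re - 1) * k x : ℝ) : ℂ) := by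
      rw [mellin, ← integral_complex_ofReal]
      refine setIntegral_congr_fun measurableSet_Ioi fun x hx => ?_
      simp only [smul_eq_mul]
      rw [ofReal_mul, ofReal_cpow (le_of_lt hx)]
      simp
    rw [key fun x => ‖g ((n + 1) * x)‖, key fun x => ‖g x‖] at h
    have h' : ∫ x in Ioi (0 : ℝ), ‖(x : ℂ) ^ (s - 1) • g ((n + 1) * x)‖ =
        ∫ x in Ioi (0 : ℝ), x ^ (s.re - 1) * ‖g ((n + 1) * x)‖ := by
      refine setIntegral_congr_fun measurableSet_Ioi fun x hx => ?_
      simp only [norm_smul]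
      rw [norm_cpow_eq_rpow_re_of_pos hx, sub_re, one_re]
    rw [h', ← ofReal_inj, h, smul_eq_mul, ofReal_mul, ofReal_cpow (hpos n).le]
    simp
  have hsum := hasSum_integral_of_summable_integral_norm
    (F := fun (n : ℕ) (x : ℝ) => (x : ℂ) ^ (s - 1) • g ((n + 1) * x)) (fun n => hint n) (by
      simp_rw [hnorm]
      refine Summable.mul_right _ ?_
      have := (summable_nat_add_iff 1).mpr (Real.summable_nat_rpow.mpr (neg_lt_neg hs))
      simpa using this)
  simp_rw [mellin, ← tsum_const_smul'']
  rw [← hsum.tsum_eq]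
  have (n : ℕ) : ∫ x in Ioi (0 : ℝ), (x : ℂ) ^ (s - 1) • g ((n + 1) * x) =
      1 / (n + 1 : ℂ) ^ s * mellin g s := by
    have := mellin_comp_mul_left g s (hpos n)
    rw [mellin] at this
    rw [this, smul_eq_mul, cpow_neg]
    simp
  simp_rw [this]
  rw [tsum_mul_right, zeta_eq_tsum_one_div_nat_add_one_cpow hs, mellin]

/-! ### The trapezoidal rule with second-order error -/

/-- Two integrations by parts against the kernel `(x - a)(a + 1 - x)/2`, which vanishes at both
ends; they are carried out at once through an explicit primitive. -/
lemma trapezoid_sub_integral {G G' G'' : ℝ → ℂ} {a : ℝ}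
    (hG : ∀ x ∈ Icc a (a + 1), HasDerivAt G (G' x) x)
    (hG' : ∀ x ∈ Icc a (a + 1), HasDerivAt G' (G'' x) x)
    (hc : ContinuousOn G'' (Icc a (a + 1))) :
    (G a + G (a + 1)) / 2 - ∫ x in a..a + 1, G x =
      ∫ x in a..a + 1, (((x - a) * (a + 1 - x) / 2 : ℝ) : ℂ) * G'' x := by
  have hle : a ≤ a + 1 := by linarith
  have hGc : ContinuousOn G (uIcc a (a + 1)) := by
    rw [uIcc_of_le hle]
    exact fun x hx => (hG x hx).continuousAt.continuousWithinAt
  have hGc'' : ContinuousOn (fun x : ℝ => (((x - a) * (a + 1 - x) / 2 : ℝ) : ℂ) * G'' x)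
      (uIcc a (a + 1)) := by
    rw [uIcc_of_le hle]
    exact (by fun_prop : Continuous fun x : ℝ =>
      (((x - a) * (a + 1 - x) / 2 : ℝ) : ℂ)).continuousOn.mul hc
  have key := intervalIntegral.integral_eq_sub_of_hasDerivAt (a := a) (b := a + 1)
    (f := fun x : ℝ => (((x - a) * (a + 1 - x) / 2 : ℝ) : ℂ) * G' x
      - ((a + 1 / 2 - x : ℝ) : ℂ) * G x)
    (f' := fun x : ℝ => (((x - a) * (a + 1 - x) / 2 : ℝ) : ℂ) * G'' x + G x) ?_
    (hGc''.add hGc).intervalIntegrable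
  · rw [intervalIntegral.integral_add hGc''.intervalIntegrable hGc.intervalIntegrable] at key
    push_cast at key ⊢
    linear_combination -key
  · intro x hx
    rw [uIcc_of_le hle] at hx
    have h1 : HasDerivAt (fun x : ℝ => (((x - a) * (a + 1 - x) / 2 : ℝ) : ℂ))
        ((a + 1 / 2 - x : ℝ) : ℂ) x := by
      have : HasDerivAt (fun x : ℝ => (x - a) * (a + 1 - x) / 2) (a + 1 / 2 - x) x := by
        have := ((((hasDerivAt_id x).sub_const a).mul ((hasDerivAt_id x).const_sub (a + 1))).div_const
          2)
        refine this.congr_deriv ?_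
        simp only [id]
        ring
      exact this.ofReal_comp
    have h2 : HasDerivAt (fun x : ℝ => ((a + 1 / 2 - x : ℝ) : ℂ)) ((-1 : ℝ) : ℂ) x :=
      ((hasDerivAt_id x).const_sub (a + 1 / 2)).ofReal_comp
    refine ((h1.mul (hG' x hx)).sub (h2.mul (hG x hx))).congr_deriv ?_
    push_cast
    ring

/-- The kernel is at most `1/8`, so the error on `[n, n + 1]` is at most `B/8 · exp(-b n)`; these
bounds form a geometric series. -/
lemma norm_sum_add_half_sub_integral_le {G G' G'' : ℝ → ℂ} {B b : ℝ} (hb : 0 < b)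
    (hG : ∀ x, 0 ≤ x → HasDerivAt G (G' x) x) (hG' : ∀ x, 0 ≤ x → HasDerivAt G' (G'' x) x)
    (hc : ContinuousOn G'' (Ici 0)) (hB : ∀ x, 0 ≤ x → ‖G'' x‖ ≤ B * Real.exp (-(b * x)))
    (hint : IntegrableOn G (Ioi 0)) (hsum : Summable fun n : ℕ => G ((n : ℝ) + 1)) :
    ‖∑' n : ℕ, G ((n : ℝ) + 1) + G 0 / 2 - ∫ x in Ioi (0 : ℝ), G x‖ ≤
      B / 8 / (1 - Real.exp (-b)) := by
  have hB0 : 0 ≤ B := by simpa using (norm_nonneg _).trans (hB 0 le_rfl)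
  set e : ℕ → ℂ := fun n => (G n + G (n + 1)) / 2 - ∫ x in (n : ℝ)..n + 1, G x
  have he (n : ℕ) : ‖e n‖ ≤ B / 8 * Real.exp (-b) ^ n := by
    have hn : (0 : ℝ) ≤ n := n.cast_nonneg
    simp only [e]
    rw [trapezoid_sub_integral (fun x hx => hG x (hn.trans hx.1)) (fun x hx => hG' x (hn.trans hx.1))
      (hc.mono fun x hx => hn.trans hx.1)]
    have := intervalIntegral.norm_integral_le_of_norm_le_const (a := (n : ℝ)) (b := n + 1)
      (C := B / 8 * Real.exp (-b) ^ n)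
      (f := fun x : ℝ => (((x - n) * (n + 1 - x) / 2 : ℝ) : ℂ) * G'' x) ?_
    · simpa using this
    · intro x hx
      rw [uIoc_of_le (by linarith)] at hx
      rw [norm_mul, norm_real, Real.norm_eq_abs, abs_of_nonneg (by nlinarith [hx.1, hx.2])]
      have h1 : (x - n) * (n + 1 - x) / 2 ≤ 1 / 8 := by nlinarith [sq_nonneg (x - n - 1 / 2)]
      have h2 : ‖G'' x‖ ≤ B * Real.exp (-b) ^ n := by
        refine (hB x (hn.trans hx.1.le)).trans ?_
        rw [← Real.exp_nat_mul]
        gcongr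
        nlinarith [hx.1]
      calc _ ≤ 1 / 8 * (B * Real.exp (-b) ^ n) := by gcongr
        _ = _ := by ring
  have hlt : Real.exp (-b) < 1 := Real.exp_lt_one_iff.mpr (by linarith)
  have hgeom := (hasSum_geometric_of_lt_one (Real.exp_pos (-b)).le hlt).mul_left (B / 8)
  have hes : Summable e := Summable.of_norm_bounded hgeom.summable he
  have hsum0 : Summable fun n : ℕ => G (n : ℝ) := by
    refine (summable_nat_add_iff 1).mp ?_
    simpa using hsum
  have hI : HasSum (fun n : ℕ => ∫ x in (n : ℝ)..n + 1, G x) (∫ x in Ioi (0 : ℝ), G x) := by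
    have hs : Summable fun n : ℕ => ∫ x in (n : ℝ)..n + 1, G x := by
      have := ((hsum0.add hsum).div_const 2).sub hes
      simpa [e] using this
    rw [hs.hasSum_iff_tendsto_nat]
    have h := (intervalIntegral_tendsto_integral_Ioi 0 hint tendsto_id).comp
      (tendsto_natCast_atTop_atTop (R := ℝ))
    refine h.congr fun N => ?_
    have := intervalIntegral.sum_integral_adjacent_intervals (f := G) (μ := volume)
      (a := fun n : ℕ => (n : ℝ)) (n := N) fun k _ => ?_
    · simpa using this.symm
    · refine ContinuousOn.intervalIntegrable fun x hx => ?_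
      rw [uIcc_of_le (by simp)] at hx
      exact (hG x ((Nat.cast_nonneg k).trans hx.1)).continuousAt.continuousWithinAt
  have htot : HasSum e (∑' n : ℕ, G ((n : ℝ) + 1) + G 0 / 2 - ∫ x in Ioi (0 : ℝ), G x) := by
    have h := ((hsum0.hasSum.add hsum.hasSum).div_const 2).sub hI
    have heq : ∑' n : ℕ, G (n : ℝ) = G 0 + ∑' n : ℕ, G ((n : ℝ) + 1) := by
      rw [hsum0.tsum_eq_zero_add]
      simp
    rw [heq, show (G 0 + ∑' n : ℕ, G ((n : ℝ) + 1) + ∑' n : ℕ, G ((n : ℝ) + 1)) / 2 =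
      ∑' n : ℕ, G ((n : ℝ) + 1) + G 0 / 2 by ring] at h
    exact h
  rw [← htot.tsum_eq]
  refine (tsum_of_norm_bounded hgeom he).trans (le_of_eq (by rw [div_eq_mul_inv (B / 8)]))

/-! ### The regularised kernel: holomorphy and decay in sectors -/

/-- The entire function `(exp w - 1) / w`. -/
noncomputable def expQuot : ℂ → ℂ := dslope exp 0

/-- The function `1 / (exp w - 1) - exp (-w) / w`, with its singularity at `0` removed. -/
noncomputable def regPart (w : ℂ) : ℂ := -dslope (fun u => expQuot (-u)) 0 w / expQuot w

lemma expQuot_zero : expQuot 0 = 1 := by simp [expQuot, Complex.deriv_exp]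

lemma expQuot_of_ne {w : ℂ} (hw : w ≠ 0) : expQuot w = (exp w - 1) / w := by
  simp [expQuot, dslope_of_ne _ hw, slope_def_field]

lemma differentiable_dslope {g : ℂ → ℂ} (hg : Differentiable ℂ g) (c : ℂ) :
    Differentiable ℂ (dslope g c) :=
  differentiableOn_univ.mp ((Complex.differentiableOn_dslope univ_mem).mpr hg.differentiableOn)

lemma differentiable_expQuot : Differentiable ℂ expQuot :=
  differentiable_dslope Complex.differentiable_exp 0

/-- Differentiating `w · expQuot w = exp w - 1` twice at `0` gives `2 · expQuot' 0 = 1`. -/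
lemma deriv_expQuot_zero : deriv expQuot 0 = 1 / 2 := by
  have hd : Differentiable ℂ (deriv expQuot) := by
    have := (differentiable_expQuot.contDiff (n := 2)).differentiable_deriv_two
    exact this
  have h1 (w : ℂ) : expQuot w + w * deriv expQuot w = exp w := by
    have h2 : (fun w => w * expQuot w) = fun w => exp w - 1 := by
      ext w
      rcases eq_or_ne w 0 with rfl | hw
      · simp
      · rw [expQuot_of_ne hw]; field_simp
    have h3 := (hasDerivAt_id w).mul (differentiable_expQuot w).hasDerivAt
    have h4 : HasDerivAt (fun w => w * expQuot w) (exp w) w := by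
      rw [h2]; exact (Complex.hasDerivAt_exp w).sub_const 1
    have := h3.unique h4
    simpa using this
  have h5 := (differentiable_expQuot 0).hasDerivAt.add
    ((hasDerivAt_id (0 : ℂ)).mul (hd 0).hasDerivAt)
  have h6 : HasDerivAt (fun w => expQuot w + w * deriv expQuot w) 1 0 := by
    simp_rw [h1]
    simpa using Complex.hasDerivAt_exp 0
  have := h5.unique h6
  simp only [id, one_mul, zero_mul, add_zero] at this
  linear_combination this / 2

lemma regPart_zero : regPart 0 = 1 / 2 := by
  have : deriv (fun u => expQuot (-u)) 0 = -(1 / 2) := by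
    rw [deriv_comp_neg (f := expQuot), neg_zero, deriv_expQuot_zero]
  simp [regPart, expQuot_zero, this]

/-- Subtracting `exp(-w)/w` rather than `1/w` cancels the pole at `0` while keeping exponential
decay at infinity, and its sum over `w = n z` is an explicit logarithm. -/
lemma regPart_of_ne {w : ℂ} (hw : w ≠ 0) (he : exp w ≠ 1) :
    regPart w = 1 / (exp w - 1) - exp (-w) / w := by
  have h1 : exp w - 1 ≠ 0 := sub_ne_zero.mpr he
  have h0 := exp_ne_zero w
  rw [regPart, dslope_of_ne _ hw, slope_def_field, neg_zero, expQuot_zero, expQuot_of_ne hw,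
    expQuot_of_ne (neg_ne_zero.mpr hw), exp_neg]
  field_simp
  ring

/-- An open set containing all closed sectors in the right half plane, on which `exp w ≠ 1` except
at `0`. -/
def regDomain : Set ℂ := {w | 0 < w.re} ∪ Metric.ball 0 2

lemma isOpen_regDomain : IsOpen regDomain :=
  (isOpen_lt continuous_const continuous_re).union Metric.isOpen_ball

lemma exp_ne_one_of_re_pos {w : ℂ} (hw : 0 < w.re) : exp w ≠ 1 := by
  intro h
  have := congrArg norm h
  rw [Complex.norm_exp, norm_one, Real.exp_eq_one_iff] at this
  exact hw.ne' this

lemma expQuot_ne_zero {w : ℂ} (hw : w ∈ regDomain) : expQuot w ≠ 0 := by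
  rcases eq_or_ne w 0 with rfl | h0
  · simp [expQuot_zero]
  rw [expQuot_of_ne h0]
  refine div_ne_zero (sub_ne_zero.mpr ?_) h0
  rcases hw with hw | hw
  · exact exp_ne_one_of_re_pos hw
  · intro h
    obtain ⟨n, rfl⟩ := Complex.exp_eq_one_iff.mp h
    have hn : n ≠ 0 := by rintro rfl; simp at h0
    have h1 : (1 : ℝ) ≤ |(n : ℝ)| := by exact_mod_cast Int.one_le_abs hn
    have := Real.pi_gt_three
    rw [mem_ball_zero_iff, norm_mul, norm_mul, norm_mul, norm_I, Complex.norm_intCast, norm_real,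
      Real.norm_eq_abs, abs_of_pos Real.pi_pos] at hw
    norm_num at hw
    nlinarith

lemma differentiableOn_regPart : DifferentiableOn ℂ regPart regDomain := by
  intro w hw
  refine DifferentiableAt.differentiableWithinAt (DifferentiableAt.div ?_
    (differentiable_expQuot w) (expQuot_ne_zero hw))
  exact (differentiable_dslope (differentiable_expQuot.comp differentiable_neg) 0 w).neg

lemma norm_exp_sub_one_inv_le {w : ℂ} {a : ℝ} (ha : 0 < a) (hw : a ≤ w.re) :
    ‖1 / (exp w - 1)‖ ≤ Real.exp (-w.re) / (1 - Real.exp (-a)) := by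
  have h1 : Real.exp (-a) < 1 := Real.exp_lt_one_iff.mpr (by linarith)
  have h2 : Real.exp w.re * (1 - Real.exp (-a)) ≤ ‖exp w - 1‖ := by
    have h3 := norm_sub_norm_le (exp w) 1
    rw [Complex.norm_exp, norm_one] at h3
    refine le_trans ?_ h3
    have : 1 ≤ Real.exp w.re * Real.exp (-a) := by
      rw [← Real.exp_add]; exact Real.one_le_exp (by linarith)
    linarith
  rw [norm_div, norm_one, Real.exp_neg, inv_eq_one_div, div_div]
  exact one_div_le_one_div_of_le (by have := Real.exp_pos w.re; nlinarith) h2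

/-- Compactness handles the unit disc, the explicit formula the rest. The margin `c/4` around the
sector leaves room for a Cauchy estimate of uniform radius. -/
lemma exists_norm_regPart_le_near_sector {c : ℝ} (hc : 0 < c) (hc1 : c ≤ 1) :
    ∃ C : ℝ, 0 ≤ C ∧ ∀ w u : ℂ, c * ‖w‖ ≤ w.re → ‖u - w‖ ≤ c / 4 →
      u ∈ regDomain ∧ ‖regPart u‖ ≤ C * Real.exp (-u.re) := by
  obtain ⟨C1, hC1⟩ := (isCompact_closedBall (0 : ℂ) 1).exists_bound_of_continuousOn
    (differentiableOn_regPart.continuousOn.mono fun w hw =>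
      Or.inr ((mem_closedBall_zero_iff.mp hw).trans_lt one_lt_two |> mem_ball_zero_iff.mpr))
  have hC10 : 0 ≤ C1 := (norm_nonneg _).trans (hC1 0 (by simp))
  have hlt : Real.exp (-(c / 2)) < 1 := Real.exp_lt_one_iff.mpr (by linarith)
  have hinv : 0 < 1 / (1 - Real.exp (-(c / 2))) := by
    apply one_div_pos.mpr; linarith
  refine ⟨C1 * Real.exp 1 + (1 / (1 - Real.exp (-(c / 2))) + 1), by positivity,
    fun w u hw hu => ?_⟩
  rcases le_or_gt ‖u‖ 1 with h1 | h1
  · refine ⟨Or.inr (mem_ball_zero_iff.mpr (h1.trans_lt one_lt_two)), ?_⟩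
    have h2 : u.re ≤ 1 := (le_abs_self _).trans ((abs_re_le_norm u).trans h1)
    have h3 : (1 : ℝ) ≤ Real.exp 1 * Real.exp (-u.re) := by
      rw [← Real.exp_add]; exact Real.one_le_exp (by linarith)
    have h4 := hC1 u (mem_closedBall_zero_iff.mpr h1)
    have h5 := Real.exp_pos (-u.re)
    nlinarith
  · have h2 : 1 - c / 4 ≤ ‖w‖ := by
      have : ‖u‖ - ‖w‖ ≤ ‖u - w‖ := norm_sub_norm_le u w
      linarith
    have h3 : c / 2 ≤ u.re := by
      have := (abs_re_le_norm (u - w)).trans hu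
      rw [sub_re, abs_le] at this
      nlinarith
    have hu0 : 0 < u.re := by linarith
    have hu1 : u ≠ 0 := by rintro rfl; simp at hu0
    refine ⟨Or.inl hu0, ?_⟩
    rw [regPart_of_ne hu1 (exp_ne_one_of_re_pos hu0)]
    have h4 := norm_exp_sub_one_inv_le (by linarith : 0 < c / 2) h3
    have h5 : ‖exp (-u) / u‖ ≤ Real.exp (-u.re) := by
      rw [norm_div, Complex.norm_exp, neg_re]
      exact div_le_self (Real.exp_pos _).le h1.le
    have h6 : 0 ≤ C1 * Real.exp 1 * Real.exp (-u.re) := by positivity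
    calc _ ≤ ‖1 / (exp u - 1)‖ + ‖exp (-u) / u‖ := norm_sub_le _ _
      _ ≤ Real.exp (-u.re) / (1 - Real.exp (-(c / 2))) + Real.exp (-u.re) := by gcongr
      _ = (1 / (1 - Real.exp (-(c / 2))) + 1) * Real.exp (-u.re) := by ring
      _ ≤ _ := by rw [add_mul (C1 * _)]; linarith

lemma exists_norm_deriv_deriv_regPart_le {c : ℝ} (hc : 0 < c) (hc1 : c ≤ 1) :
    ∃ C : ℝ, 0 ≤ C ∧ ∀ w : ℂ, c * ‖w‖ ≤ w.re →
      w ∈ regDomain ∧ ‖regPart w‖ ≤ C * Real.exp (-w.re) ∧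
        ‖deriv (deriv regPart) w‖ ≤ C * Real.exp (-w.re) := by
  obtain ⟨C, hC0, hC⟩ := exists_norm_regPart_le_near_sector hc hc1
  have h4 : 0 < c / 4 := by positivity
  refine ⟨C + 2 * (C * Real.exp (c / 4)) / (c / 4) ^ 2, by positivity, fun w hw => ?_⟩
  obtain ⟨h1, h2⟩ := hC w w hw (by simpa using h4.le)
  refine ⟨h1, h2.trans ?_, ?_⟩
  · gcongr
    exact le_add_of_nonneg_right (by positivity)
  · have hsub : Metric.closedBall w (c / 4) ⊆ regDomain := fun u hu =>
      (hC w u hw (mem_closedBall_iff_norm.mp hu)).1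
    -- Cauchy's estimate on a circle of radius `c/4`, along which `exp(-Re u)` changes by at most
    -- the factor `exp(c/4)`.
    have := norm_iteratedDeriv_le_of_forall_mem_sphere_norm_le (f := regPart) 2 h4
      (DifferentiableOn.diffContOnCl (by
        rw [closure_ball w h4.ne']; exact differentiableOn_regPart.mono hsub))
      (C := C * (Real.exp (c / 4) * Real.exp (-w.re))) ?_
    · rw [iteratedDeriv_succ, iteratedDeriv_one] at this
      refine this.trans ?_
      rw [add_mul]
      refine le_trans (le_of_eq ?_) (le_add_of_nonneg_left (by positivity))
      simp [Nat.factorial]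
      ring
    · intro u hu
      rw [mem_sphere_iff_norm] at hu
      refine (hC w u hw hu.le).2.trans ?_
      gcongr
      rw [← Real.exp_add]
      gcongr
      have := (abs_re_le_norm (u - w)).trans hu.le
      rw [sub_re, abs_le] at this
      linarith

/-! ### The Lambert series and its Mellin transform -/

/-- The Lambert series `∑ 1 / (exp (n z) - 1) = ∑ d(n) exp (-n z)`. -/
noncomputable def lambert (z : ℂ) : ℂ := ∑' n : ℕ, 1 / (exp ((n + 1) * z) - 1)

lemma re_natCast_add_one_mul (n : ℕ) (z : ℂ) : ((n + 1 : ℂ) * z).re = (n + 1) * z.re := by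
  simp

lemma norm_lambert_term_le {z : ℂ} {a : ℝ} (ha : 0 < a) (hz : a ≤ z.re) (n : ℕ) :
    ‖1 / (exp ((n + 1) * z) - 1)‖ ≤
      Real.exp (-a) / (1 - Real.exp (-a)) * Real.exp (-a) ^ n := by
  have hre := re_natCast_add_one_mul n z
  have hn : (0 : ℝ) ≤ n := n.cast_nonneg
  have h := norm_exp_sub_one_inv_le (w := (n + 1) * z) ha (by rw [hre]; nlinarith)
  refine h.trans ?_
  have h1 : Real.exp (-a) < 1 := Real.exp_lt_one_iff.mpr (by linarith)
  rw [hre, div_mul_eq_mul_div, ← Real.exp_nat_mul, ← Real.exp_add]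
  have : 0 < 1 - Real.exp (-a) := by linarith
  gcongr
  nlinarith

lemma hasSum_lambert_bound {a : ℝ} (ha : 0 < a) :
    HasSum (fun n : ℕ => Real.exp (-a) / (1 - Real.exp (-a)) * Real.exp (-a) ^ n)
      (Real.exp (-a) / (1 - Real.exp (-a)) * (1 - Real.exp (-a))⁻¹) :=
  (hasSum_geometric_of_lt_one (Real.exp_pos (-a)).le
    (Real.exp_lt_one_iff.mpr (by linarith))).mul_left _

lemma summable_lambert {z : ℂ} (hz : 0 < z.re) :
    Summable fun n : ℕ => 1 / (exp ((n + 1) * z) - 1) :=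
  Summable.of_norm_bounded (hasSum_lambert_bound hz).summable (norm_lambert_term_le hz le_rfl)

lemma norm_lambert_le {z : ℂ} (hz : 0 < z.re) :
    ‖lambert z‖ ≤ Real.exp (-z.re) / (1 - Real.exp (-z.re)) * (1 - Real.exp (-z.re))⁻¹ :=
  tsum_of_norm_bounded (hasSum_lambert_bound hz) (norm_lambert_term_le hz le_rfl)

lemma continuousOn_lambert : ContinuousOn lambert {z | 0 < z.re} := by
  intro z hz
  have hz2 : 0 < z.re / 2 := half_pos hz
  have hopen : IsOpen {w : ℂ | z.re / 2 < w.re} := isOpen_lt continuous_const continuous_re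
  refine ContinuousAt.continuousWithinAt (ContinuousOn.continuousAt (s := {w | z.re / 2 < w.re}) ?_
    (hopen.mem_nhds (half_lt_self (show 0 < z.re from hz))))
  refine continuousOn_tsum (fun n => ?_) (hasSum_lambert_bound hz2).summable
    fun n w hw => norm_lambert_term_le hz2 (le_of_lt hw) n
  refine ContinuousOn.div continuousOn_const (by fun_prop) fun w hw => sub_ne_zero.mpr ?_
  refine exp_ne_one_of_re_pos ?_
  rw [re_natCast_add_one_mul]
  have : 0 < w.re := hz2.trans hw
  positivity

lemma lambert_add_two_pi_mul_I (z : ℂ) : lambert (z + 2 * Real.pi * I) = lambert z := by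
  unfold lambert
  congr 1
  ext n
  have h := Complex.exp_periodic.nat_mul (n + 1) ((n + 1) * z)
  rw [show ((n : ℂ) + 1) * (z + 2 * Real.pi * I) =
    (n + 1) * z + ((n + 1 : ℕ) : ℂ) * (2 * Real.pi * I) by push_cast; ring, h]

lemma hasSum_exp_div {z : ℂ} (hz : 0 < z.re) :
    HasSum (fun n : ℕ => exp (-((n + 1) * z)) / ((n + 1) * z)) (-log (1 - exp (-z)) / z) := by
  have hz0 : z ≠ 0 := by rintro rfl; simp at hz
  have h1 : ‖exp (-z)‖ < 1 := by
    rw [Complex.norm_exp, Real.exp_lt_one_iff]; simpa using hz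
  have h := (hasSum_nat_add_iff' 1).mpr (Complex.hasSum_taylorSeries_neg_log h1)
  simp only [Finset.range_one, Finset.sum_singleton, pow_zero, Nat.cast_zero, div_zero,
    sub_zero] at h
  refine (h.div_const z).congr_fun fun n => ?_
  rw [← Complex.exp_nat_mul, div_div]
  push_cast
  ring_nf

lemma regPart_term {z : ℂ} (hz : 0 < z.re) (n : ℕ) : regPart ((n + 1) * z) =
    1 / (exp ((n + 1) * z) - 1) - exp (-((n + 1) * z)) / ((n + 1) * z) := by
  have h : 0 < ((n + 1 : ℂ) * z).re := by rw [re_natCast_add_one_mul]; positivity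
  exact regPart_of_ne (by intro h0; simp [h0] at h) (exp_ne_one_of_re_pos h)

lemma hasSum_regPart {z : ℂ} (hz : 0 < z.re) :
    HasSum (fun n : ℕ => regPart ((n + 1) * z)) (lambert z + log (1 - exp (-z)) / z) := by
  have h := (summable_lambert hz).hasSum.sub (hasSum_exp_div hz)
  simp_rw [regPart_term hz]
  rw [neg_div, sub_neg_eq_add] at h
  exact h

lemma norm_mul_ofReal_sector {z : ℂ} {c x : ℝ} (hc : c * ‖z‖ ≤ z.re) (hx : 0 ≤ x) :
    c * ‖z * x‖ ≤ (z * x).re := by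
  rw [norm_mul, norm_real, Real.norm_eq_abs, abs_of_nonneg hx, re_mul_ofReal]
  nlinarith

lemma exists_sector {z : ℂ} (hz : 0 < z.re) : ∃ c : ℝ, 0 < c ∧ c ≤ 1 ∧ c * ‖z‖ ≤ z.re := by
  have hz0 : 0 < ‖z‖ := hz.trans_le ((le_abs_self _).trans (abs_re_le_norm z))
  refine ⟨z.re / ‖z‖, by positivity, ?_, by rw [div_mul_cancel₀ _ hz0.ne']⟩
  exact (div_le_one hz0).mpr ((le_abs_self _).trans (abs_re_le_norm z))

lemma continuousOn_regPart_ray {z : ℂ} (hz : 0 < z.re) :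
    ContinuousOn (fun x : ℝ => regPart (z * x)) (Ici 0) := by
  obtain ⟨c, hc, hc1, hcz⟩ := exists_sector hz
  obtain ⟨C, -, hC⟩ := exists_norm_deriv_deriv_regPart_le hc hc1
  exact differentiableOn_regPart.continuousOn.comp (by fun_prop)
    fun x hx => (hC _ (norm_mul_ofReal_sector hcz hx)).1

lemma exists_norm_regPart_ray_le {z : ℂ} (hz : 0 < z.re) :
    ∃ C : ℝ, ∀ x : ℝ, 0 ≤ x → ‖regPart (z * x)‖ ≤ C * Real.exp (-z.re * x) := by
  obtain ⟨c, hc, hc1, hcz⟩ := exists_sector hz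
  obtain ⟨C, -, hC⟩ := exists_norm_deriv_deriv_regPart_le hc hc1
  refine ⟨C, fun x hx => ((hC _ (norm_mul_ofReal_sector hcz hx)).2.1).trans_eq ?_⟩
  simp

lemma regPart_ray_isBigO {z : ℂ} (hz : 0 < z.re) :
    LocallyIntegrableOn (fun x : ℝ => regPart (z * x)) (Ioi 0) ∧
    (fun x : ℝ => regPart (z * x)) =O[atTop] (fun x => Real.exp (-z.re * x)) ∧
    (fun x : ℝ => regPart (z * x)) =O[𝓝[>] 0] (fun x : ℝ => x ^ (-0 : ℝ)) := by
  obtain ⟨C, hC⟩ := exists_norm_regPart_ray_le hz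
  refine ⟨((continuousOn_regPart_ray hz).mono Ioi_subset_Ici_self).locallyIntegrableOn
    measurableSet_Ioi, ?_, ?_⟩
  · refine IsBigO.of_bound C ((eventually_ge_atTop 0).mono fun x hx => ?_)
    rw [Real.norm_eq_abs, Real.abs_exp]
    exact hC x hx
  · have h := (continuousOn_regPart_ray hz) 0 self_mem_Ici
    simp only [neg_zero, Real.rpow_zero]
    exact (h.mono Ioi_subset_Ici_self).tendsto.isBigO_one ℝ

lemma mellinConvergent_regPart {z s : ℂ} (hz : 0 < z.re) (hs : 0 < s.re) :
    MellinConvergent (fun x : ℝ => regPart (z * x)) s := by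
  obtain ⟨h1, h2, h3⟩ := regPart_ray_isBigO hz
  exact mellinConvergent_of_isBigO_rpow_exp hz h1 h2 h3 hs

lemma hasMellin_exp_neg_div {z s : ℂ} (hz : 0 < z.re) (hs : 1 < s.re) :
    HasMellin (fun x : ℝ => exp (-(z * x)) / (z * x)) s (Gamma (s - 1) * z ^ (-s)) := by
  have hz0 : z ≠ 0 := by rintro rfl; simp at hz
  have hs' : 0 < (s + -1).re := by simpa using hs
  have heq : (fun x : ℝ => exp (-(z * x)) / (z * x)) =
      fun x : ℝ => z⁻¹ • ((x : ℂ) ^ (-1 : ℂ) • exp (-(z * x))) := by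
    ext x
    simp only [smul_eq_mul, cpow_neg_one]
    rw [div_eq_mul_inv, mul_inv]; ring
  rw [heq]
  constructor
  · exact (MellinConvergent.cpow_smul.mpr (mellinConvergent_exp_neg_mul hz hs')).const_smul _
  · rw [mellin_const_smul, mellin_cpow_smul, mellin_exp_neg_mul hz hs', smul_eq_mul,
      show -(s + -1) = -s + 1 by ring, cpow_add _ _ hz0, cpow_one, ← sub_eq_add_neg]
    field_simp

lemma hasSum_exp_neg_mul {w : ℂ} (hw : 0 < w.re) :
    HasSum (fun n : ℕ => exp (-((n + 1) * w))) (1 / (exp w - 1)) := by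
  have h1 : ‖exp (-w)‖ < 1 := by
    rw [Complex.norm_exp, Real.exp_lt_one_iff]; simpa using hw
  have h := (hasSum_geometric_of_norm_lt_one h1).mul_left (exp (-w))
  have he : exp w - 1 ≠ 0 := sub_ne_zero.mpr (exp_ne_one_of_re_pos hw)
  have h0 := exp_ne_zero w
  have heq : exp (-w) * (1 - exp (-w))⁻¹ = 1 / (exp w - 1) := by
    rw [Complex.exp_neg]
    have : 1 - (exp w)⁻¹ ≠ 0 := by
      intro h2; apply he; field_simp at h2; simpa using h2
    field_simp
  rw [heq] at h
  refine h.congr_fun fun n => ?_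
  rw [← Complex.exp_nat_mul, ← Complex.exp_add]
  ring_nf

lemma hasMellin_exp_sub_one_inv {z s : ℂ} (hz : 0 < z.re) (hs : 1 < s.re) :
    HasMellin (fun x : ℝ => 1 / (exp (z * x) - 1)) s (riemannZeta s * (Gamma s * z ^ (-s))) := by
  have hpos {x : ℝ} (hx : x ∈ Ioi (0 : ℝ)) : 0 < (z * x).re := by
    rw [re_mul_ofReal]; exact mul_pos hz hx
  constructor
  · have h := (hasMellin_add (mellinConvergent_regPart hz (zero_lt_one.trans hs))
      (hasMellin_exp_neg_div hz hs).1).1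
    refine h.congr_fun (fun x hx => ?_) measurableSet_Ioi
    have hzx := hpos hx
    have := regPart_of_ne (by intro h0; simp [h0] at hzx) (exp_ne_one_of_re_pos hzx)
    simp only [this, sub_add_cancel]
  · rw [← mellin_exp_neg_mul hz (zero_lt_one.trans hs),
      ← mellin_tsum_comp_mul (mellinConvergent_exp_neg_mul hz (zero_lt_one.trans hs)) hs]
    refine setIntegral_congr_fun measurableSet_Ioi fun x hx => ?_
    simp only
    rw [← (hasSum_exp_neg_mul (hpos hx)).tsum_eq]
    congr 3
    ext n
    push_cast
    ring_nf

lemma mellin_lambert {z s : ℂ} (hz : 0 < z.re) (hs : 1 < s.re) :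
    mellin (fun x : ℝ => lambert (z * x)) s = Gamma s * riemannZeta s ^ 2 * z ^ (-s) := by
  obtain ⟨h1, h2⟩ := hasMellin_exp_sub_one_inv hz hs
  have h := mellin_tsum_comp_mul h1 hs
  rw [h2] at h
  rw [show Gamma s * riemannZeta s ^ 2 * z ^ (-s) =
    riemannZeta s * (riemannZeta s * (Gamma s * z ^ (-s))) by ring, ← h]
  congr 1
  ext x
  unfold lambert
  congr 1
  ext n
  push_cast
  ring_nf

/-- For `s > 1` the Mellin transform of `regPart (z x)` is `Γ(s) z^(-s) (ζ(s) - 1/(s - 1))`. It is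
continuous at `s = 1`, where the bracket tends to `γ`. -/
lemma integral_regPart {z : ℂ} (hz : 0 < z.re) :
    IntegrableOn (fun x : ℝ => regPart (z * x)) (Ioi 0) ∧
      ∫ x in Ioi (0 : ℝ), regPart (z * x) = Real.eulerMascheroniConstant / z := by
  have h1 := mellinConvergent_regPart hz (s := 1) (by simp)
  have hm : mellin (fun x : ℝ => regPart (z * x)) 1 = ∫ x in Ioi (0 : ℝ), regPart (z * x) := by
    simp [mellin]
  refine ⟨by simpa [MellinConvergent] using h1, ?_⟩
  rw [← hm]
  obtain ⟨b1, b2, b3⟩ := regPart_ray_isBigO hz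
  have hz0 : z ≠ 0 := by rintro rfl; simp at hz
  have hcont := (mellin_differentiableAt_of_isBigO_rpow_exp (s := 1) hz b1 b2 b3
    (by simp)).continuousAt
  have hto : Tendsto (fun x : ℝ => (x : ℂ)) (𝓝[>] 1) (𝓝[≠] 1) := by
    refine tendsto_nhdsWithin_iff.mpr ⟨?_, ?_⟩
    · have := continuous_ofReal.tendsto 1
      rw [ofReal_one] at this
      exact this.mono_left nhdsWithin_le_nhds
    · filter_upwards [self_mem_nhdsWithin] with x hx
      simpa using (ne_of_gt hx)
  have hl := hcont.tendsto.comp (hto.mono_right nhdsWithin_le_nhds)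
  have hz1 : ContinuousAt (fun s : ℂ => Gamma s * z ^ (-s)) 1 := by
    refine ContinuousAt.mul ?_ ?_
    · refine (differentiableAt_Gamma 1 fun m => ?_).continuousAt
      intro h
      have := congrArg re h
      simp at this
      linarith [(m.cast_nonneg : (0 : ℝ) ≤ m)]
    · exact (continuousAt_const_cpow hz0).comp continuousAt_neg
  have hr := (hz1.tendsto.mono_left nhdsWithin_le_nhds).mul tendsto_riemannZeta_sub_one_div
    |>.comp hto
  refine tendsto_nhds_unique hl ((hr.congr' ?_).trans (le_of_eq ?_))
  · filter_upwards [self_mem_nhdsWithin] with x hx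
    have hx1 : 1 < (x : ℂ).re := hx
    have hx0 : (x : ℂ) - 1 ≠ 0 := by
      rw [sub_ne_zero]; exact_mod_cast (ne_of_gt hx : (x : ℝ) ≠ 1)
    obtain ⟨c1, v1⟩ := hasMellin_exp_sub_one_inv hz hx1
    obtain ⟨c2, v2⟩ := hasMellin_exp_neg_div hz hx1
    have h3 := (hasMellin_sub c1 c2).2
    rw [v1, v2] at h3
    have h4 : mellin (fun x : ℝ => regPart (z * x)) x =
        mellin (fun x : ℝ => 1 / (exp (z * x) - 1) - exp (-(z * x)) / (z * x)) x := by
      refine setIntegral_congr_fun measurableSet_Ioi fun y hy => ?_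
      have hzy : 0 < (z * y).re := by rw [re_mul_ofReal]; exact mul_pos hz hy
      have := regPart_of_ne (by intro h0; simp [h0] at hzy) (exp_ne_one_of_re_pos hzy)
      simp only [this]
    have hG : Gamma x = (x - 1) * Gamma (x - 1) := by
      have := Gamma_add_one _ hx0
      rwa [sub_add_cancel] at this
    simp only [Function.comp_apply]
    rw [h4, h3, hG]
    field_simp
  · simp [cpow_neg_one, div_eq_mul_inv, mul_comm]

/-! ### Behaviour of the Lambert series at the origin -/

lemma exists_norm_tsum_regPart_le {c : ℝ} (hc : 0 < c) (hc1 : c ≤ 1) :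
    ∃ C : ℝ, ∀ z : ℂ, z ≠ 0 → c * ‖z‖ ≤ z.re → ‖z‖ ≤ 1 →
      ‖lambert z + log (1 - exp (-z)) / z + 1 / 4 - Real.eulerMascheroniConstant / z‖ ≤
        C * ‖z‖ := by
  obtain ⟨C, hC0, hC⟩ := exists_norm_deriv_deriv_regPart_le hc hc1
  refine ⟨C / (4 * c), fun z hz0 hcz hz1 => ?_⟩
  have hzn : 0 < ‖z‖ := norm_pos_iff.mpr hz0
  have hz : 0 < z.re := (mul_pos hc hzn).trans_le hcz
  have hdom (x : ℝ) (hx : 0 ≤ x) := hC _ (norm_mul_ofReal_sector hcz hx)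
  have hmul (x : ℝ) : HasDerivAt (fun y : ℂ => z * y) z (x : ℂ) := by
    simpa using (hasDerivAt_id (x : ℂ)).const_mul z
  have han := differentiableOn_regPart.analyticOnNhd isOpen_regDomain
  -- Two derivatives in `x` give the factor `‖z‖²` in `B`; the geometric sum costs one factor `‖z‖`
  -- in the sector, leaving `O(‖z‖)`. The `1/4` is half of `regPart 0`.
  have key := norm_sum_add_half_sub_integral_le (G := fun x : ℝ => regPart (z * x))
    (G' := fun x : ℝ => deriv regPart (z * x) * z)
    (G'' := fun x : ℝ => deriv (deriv regPart) (z * x) * z * z)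
    (B := C * ‖z‖ ^ 2) (b := z.re) hz ?_ ?_ ?_ ?_ (integral_regPart hz).1 ?_
  · rw [(integral_regPart hz).2] at key
    have hs : ∑' n : ℕ, regPart (z * ((n : ℝ) + 1 : ℝ)) = lambert z + log (1 - exp (-z)) / z := by
      rw [← (hasSum_regPart hz).tsum_eq]
      congr 1
      ext n
      push_cast
      rw [mul_comm]
    rw [hs, ofReal_zero, mul_zero, regPart_zero] at key
    rw [show (1 / 4 : ℂ) = 1 / 2 / 2 by norm_num]
    refine key.trans ?_
    have he : c * ‖z‖ / 2 ≤ 1 - Real.exp (-z.re) := by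
      have h1 : Real.exp (-z.re) ≤ Real.exp (-(c * ‖z‖)) := Real.exp_le_exp.mpr (by linarith)
      have h2 : 0 ≤ c * ‖z‖ := by positivity
      have h3 : c * ‖z‖ ≤ 1 := mul_le_one₀ hc1 hzn.le hz1
      have h4 : Real.exp (-(c * ‖z‖)) ≤ 1 / (1 + c * ‖z‖) := by
        rw [Real.exp_neg, inv_eq_one_div]
        apply one_div_le_one_div_of_le (by linarith)
        linarith [Real.add_one_le_exp (c * ‖z‖)]
      have h5 : 1 / (1 + c * ‖z‖) ≤ 1 - c * ‖z‖ / 2 := by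
        rw [div_le_iff₀ (by linarith)]
        nlinarith
      linarith
    calc C * ‖z‖ ^ 2 / 8 / (1 - Real.exp (-z.re)) ≤ C * ‖z‖ ^ 2 / 8 / (c * ‖z‖ / 2) := by gcongr
      _ = _ := by field_simp; ring
  · intro x hx
    have := (han _ (hdom x hx).1).differentiableAt.hasDerivAt.comp (x : ℂ) (hmul x)
    exact this.comp_ofReal
  · intro x hx
    have := (han _ (hdom x hx).1).deriv.differentiableAt.hasDerivAt.comp (x : ℂ) (hmul x)
    exact (this.mul_const z).comp_ofReal
  · have h1 : ContinuousOn (deriv (deriv regPart)) regDomain :=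
      (han.deriv.deriv).continuousOn
    have h2 : ContinuousOn (fun x : ℝ => deriv (deriv regPart) (z * x)) (Ici 0) :=
      h1.comp (by fun_prop) fun x hx => (hdom x hx).1
    exact (h2.mul continuousOn_const).mul continuousOn_const
  · intro x hx
    have := (hdom x hx).2.2
    rw [re_mul_ofReal] at this
    rw [norm_mul, norm_mul]
    calc _ ≤ C * Real.exp (-(z.re * x)) * ‖z‖ * ‖z‖ := by gcongr
      _ = _ := by ring
  · refine (hasSum_regPart hz).summable.congr fun n => ?_
    push_cast
    rw [mul_comm]

lemma log_mul_of_re_pos {z u : ℂ} (hz : 0 < z.re) (hu : 0 < u.re) :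
    log (z * u) = log z + log u := by
  have hz0 : z ≠ 0 := by rintro rfl; simp at hz
  have hu0 : u ≠ 0 := by rintro rfl; simp at hu
  have h1 := abs_lt.mp (abs_arg_lt_pi_div_two_iff.mpr (Or.inl hz))
  have h2 := abs_lt.mp (abs_arg_lt_pi_div_two_iff.mpr (Or.inl hu))
  exact Complex.log_mul hz0 hu0 ⟨by linarith, by linarith⟩

/-- The difference between the Lambert series and its leading term at `0`. -/
noncomputable def lambertRem (z : ℂ) : ℂ :=
  lambert z - (Real.eulerMascheroniConstant - log z) / z

/-- Writing `log(1 - exp(-z)) = log z + log(expQuot(-z))`, the last term divided by `z` tends to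
`-1/2`. The limit is therefore `1/2 - 1/4`. -/
lemma tendsto_lambertRem {c : ℝ} (hc : 0 < c) (hc1 : c ≤ 1) :
    Tendsto lambertRem (𝓝[{z | z ≠ 0 ∧ c * ‖z‖ ≤ z.re}] 0) (𝓝 (1 / 4)) := by
  obtain ⟨C, hC⟩ := exists_norm_tsum_regPart_le hc hc1
  set l := 𝓝[{z : ℂ | z ≠ 0 ∧ c * ‖z‖ ≤ z.re}] 0
  have hl : l ≤ 𝓝[≠] 0 := nhdsWithin_mono _ fun z hz => hz.1
  have hmem : ∀ᶠ z in l, z ≠ 0 ∧ c * ‖z‖ ≤ z.re := self_mem_nhdsWithin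
  have hsmall : ∀ᶠ z : ℂ in l, ‖z‖ ≤ 1 :=
    (hl.trans nhdsWithin_le_nhds) ((continuous_norm.tendsto (0 : ℂ)).eventually_le_const (by simp))
  have h1 : Tendsto (fun z => lambert z + log (1 - exp (-z)) / z + 1 / 4 -
      Real.eulerMascheroniConstant / z) l (𝓝 0) := by
    refine squeeze_zero_norm' (a := fun z => C * ‖z‖) ?_ ?_
    · filter_upwards [hmem, hsmall] with z hz hz1 using hC z hz.1 hz.2 hz1
    · have : Tendsto (fun z : ℂ => C * ‖z‖) (𝓝 0) (𝓝 (C * ‖(0 : ℂ)‖)) :=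
        (by fun_prop : Continuous fun z : ℂ => C * ‖z‖).tendsto 0
      rw [norm_zero, mul_zero] at this
      exact this.mono_left (hl.trans nhdsWithin_le_nhds)
  have hd0 : HasDerivAt (fun z => expQuot (-z)) (-(1 / 2)) 0 := by
    have := (differentiable_expQuot.comp differentiable_neg 0).hasDerivAt
    have h := deriv_comp_neg (f := expQuot) (0 : ℂ)
    rw [neg_zero, deriv_expQuot_zero] at h
    exact this.congr_deriv h
  have hd : HasDerivAt (fun z => log (expQuot (-z))) (-(1 / 2)) 0 := by
    have := hd0.clog (by simp [expQuot_zero])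
    simpa [expQuot_zero] using this
  have h2 : Tendsto (fun z => log (expQuot (-z)) / z) l (𝓝 (-(1 / 2))) := by
    have := (hasDerivAt_iff_tendsto_slope_zero.mp hd).mono_left hl
    refine this.congr fun z => ?_
    simp [expQuot_zero, div_eq_inv_mul]
  have h3 : ∀ᶠ z in l, 0 < (expQuot (-z)).re := by
    have := (continuous_re.continuousAt.comp hd0.continuousAt).tendsto
    refine (hl.trans nhdsWithin_le_nhds) (this.eventually_const_lt ?_)
    simp [expQuot_zero]
  have h4 := (h1.sub h2).sub (tendsto_const_nhds (x := (1 / 4 : ℂ)))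
  rw [show (0 - -(1 / 2) - 1 / 4 : ℂ) = 1 / 4 by norm_num] at h4
  refine h4.congr' ?_
  filter_upwards [hmem, h3] with z hz hu
  have hzr : 0 < z.re := (mul_pos hc (norm_pos_iff.mpr hz.1)).trans_le hz.2
  have hq : 1 - exp (-z) = z * expQuot (-z) := by
    rw [expQuot_of_ne (neg_ne_zero.mpr hz.1)]
    field_simp [hz.1]
    ring
  rw [hq, log_mul_of_re_pos hzr hu, lambertRem]
  ring

/-! ### Continuation of the Mellin transform to the critical strip -/

lemma HasMellin.congr_Ioi {f g : ℝ → ℂ} {s m : ℂ} (h : HasMellin f s m)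
    (hfg : ∀ x, 0 < x → f x = g x) : HasMellin g s m := by
  obtain ⟨h1, rfl⟩ := h
  refine ⟨h1.congr_fun (fun x hx => ?_) measurableSet_Ioi,
    setIntegral_congr_fun measurableSet_Ioi fun x hx => ?_⟩ <;>
  simp only [hfg x hx]

lemma locallyIntegrableOn_indicator {f : ℝ → ℂ} {S T : Set ℝ} (hT : MeasurableSet T)
    (hf : LocallyIntegrableOn f S) : LocallyIntegrableOn (T.indicator f) S := by
  intro x hx
  obtain ⟨u, hu, hi⟩ := hf x hx
  exact ⟨u, hu, Integrable.indicator hi hT⟩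

lemma indicator_Ioc_isBigO_atTop (f : ℝ → ℂ) (g : ℝ → ℝ) :
    (Ioc (0 : ℝ) 1).indicator f =O[atTop] g := by
  refine (isBigO_zero g atTop).congr' ?_ EventuallyEq.rfl
  filter_upwards [eventually_gt_atTop 1] with x hx
  rw [indicator_of_notMem fun h => absurd h.2 (not_le.mpr hx)]

lemma indicator_Ioi_isBigO_zero (f : ℝ → ℂ) (g : ℝ → ℝ) :
    (Ioi (1 : ℝ)).indicator f =O[𝓝[>] 0] g := by
  refine (isBigO_zero g _).congr' ?_ EventuallyEq.rfl
  filter_upwards [nhdsWithin_le_nhds (Iio_mem_nhds zero_lt_one)] with x hx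
  rw [indicator_of_notMem fun h => absurd (mem_Ioi.mp h) (not_lt.mpr (le_of_lt hx))]

lemma isBigO_indicator {f : ℝ → ℂ} {T : Set ℝ} {l : Filter ℝ} {g : ℝ → ℝ} (h : f =O[l] g) :
    T.indicator f =O[l] g :=
  (IsBigO.of_norm_le fun x => norm_indicator_le_norm_self f x : T.indicator f =O[l] fun x => ‖f x‖)
    |>.trans h.norm_left

lemma continuousOn_ofReal_cpow (a : ℂ) : ContinuousOn (fun x : ℝ => (x : ℂ) ^ a) (Ioi 0) :=
  fun _ hx => (continuousAt_ofReal_cpow_const _ _ (Or.inr (ne_of_gt hx))).continuousWithinAt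

lemma isBigO_ofReal_inv {l : Filter ℝ} (hl : ∀ᶠ x in l, 0 < x) :
    (fun x : ℝ => (x : ℂ) ^ (-1 : ℂ)) =O[l] fun x => x ^ (-1 : ℝ) := by
  refine IsBigO.of_bound 1 (hl.mono fun x hx => ?_)
  rw [norm_cpow_eq_rpow_re_of_pos hx, one_mul]
  simp [abs_of_pos hx, Real.rpow_neg_one]

lemma hasDerivAt_one_div_sub_one {s : ℂ} (hs : s ≠ 1) :
    HasDerivAt (fun s : ℂ => 1 / (s - 1)) (-(1 / (s - 1) ^ 2)) s := by
  have := ((hasDerivAt_id s).sub_const 1).inv (sub_ne_zero.mpr hs)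
  simpa [neg_div] using! this

lemma hasMellin_inv_Ioc {s : ℂ} (hs : 1 < s.re) :
    HasMellin ((Ioc (0 : ℝ) 1).indicator fun t => (t : ℂ) ^ (-1 : ℂ)) s (1 / (s - 1)) := by
  rw [sub_eq_add_neg]
  exact hasMellin_cpow_Ioc (-1) (by simpa using hs)

/-- Differentiating a Mellin transform in `s` inserts the factor `log t`. -/
lemma hasMellin_log_inv_Ioc {s : ℂ} (hs : 1 < s.re) :
    HasMellin (fun t => Real.log t • (Ioc (0 : ℝ) 1).indicator (fun t => (t : ℂ) ^ (-1 : ℂ)) t) s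
      (-(1 / (s - 1) ^ 2)) := by
  have hs1 : s ≠ 1 := by rintro rfl; simp at hs
  obtain ⟨h1, h2⟩ := mellin_hasDerivAt_of_isBigO_rpow (a := s.re + 1) (b := 1) (s := s)
    (locallyIntegrableOn_indicator (T := Ioc 0 1) measurableSet_Ioc
      ((continuousOn_ofReal_cpow (-1)).locallyIntegrableOn measurableSet_Ioi))
    (indicator_Ioc_isBigO_atTop _ _) (by linarith)
    (isBigO_indicator (isBigO_ofReal_inv self_mem_nhdsWithin)) hs
  refine ⟨h1, h2.unique ((hasDerivAt_one_div_sub_one hs1).congr_of_eventuallyEq ?_)⟩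
  filter_upwards [(isOpen_lt continuous_const continuous_re).mem_nhds hs] with w hw
  exact (hasMellin_inv_Ioc hw).2

lemma hasMellin_inv_Ioi {s : ℂ} (hs : s.re < 1) :
    HasMellin ((Ioi (1 : ℝ)).indicator fun t => (t : ℂ) ^ (-1 : ℂ)) s (-(1 / (s - 1))) := by
  have h1 : MellinConvergent ((Ioi (1 : ℝ)).indicator fun t => (t : ℂ) ^ (-1 : ℂ)) s :=
    mellinConvergent_of_isBigO_rpow (a := 1) (b := s.re - 1)
      (locallyIntegrableOn_indicator measurableSet_Ioi
        ((continuousOn_ofReal_cpow (-1)).locallyIntegrableOn measurableSet_Ioi))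
      (isBigO_indicator (isBigO_ofReal_inv (eventually_gt_atTop 0))) hs
      (indicator_Ioi_isBigO_zero _ _) (by linarith)
  refine ⟨h1, ?_⟩
  have hsub : Ioi (1 : ℝ) ⊆ Ioi 0 := Ioi_subset_Ioi zero_le_one
  simp_rw [mellin, ← indicator_smul]
  rw [setIntegral_indicator measurableSet_Ioi, inter_eq_self_of_subset_right hsub]
  have h2 := integral_Ioi_cpow_of_lt (a := s - 1 + -1) (by simp; linarith) zero_lt_one
  simp only [ofReal_one, one_cpow, neg_add_cancel_right] at h2
  rw [← neg_div, ← h2]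
  refine setIntegral_congr_fun measurableSet_Ioi fun x hx => ?_
  have hx0 : (x : ℂ) ≠ 0 := by exact_mod_cast (ne_of_gt (hsub hx) : x ≠ 0)
  simp only [smul_eq_mul]
  rw [cpow_add _ _ hx0]

lemma hasMellin_log_inv_Ioi {s : ℂ} (hs : s.re < 1) :
    HasMellin (fun t => Real.log t • (Ioi (1 : ℝ)).indicator (fun t => (t : ℂ) ^ (-1 : ℂ)) t) s
      (1 / (s - 1) ^ 2) := by
  have hs1 : s ≠ 1 := by rintro rfl; simp at hs
  obtain ⟨h1, h2⟩ := mellin_hasDerivAt_of_isBigO_rpow (a := 1) (b := s.re - 1) (s := s)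
    (locallyIntegrableOn_indicator (T := Ioi 1) measurableSet_Ioi
      ((continuousOn_ofReal_cpow (-1)).locallyIntegrableOn measurableSet_Ioi))
    (isBigO_indicator (isBigO_ofReal_inv (eventually_gt_atTop 0))) hs
    (indicator_Ioi_isBigO_zero _ _) (by linarith)
  have h3 := (hasDerivAt_one_div_sub_one hs1).neg
  rw [neg_neg] at h3
  refine ⟨h1, h2.unique (h3.congr_of_eventuallyEq ?_)⟩
  filter_upwards [(isOpen_lt continuous_re continuous_const).mem_nhds hs] with w hw
  exact (hasMellin_inv_Ioi hw).2

/-- The leading term of the Lambert series at `0`. -/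
noncomputable def lambertMain (z : ℂ) : ℂ := (Real.eulerMascheroniConstant - log z) / z

/-- The Mellin transform of `lambertMain (z x)`, split at `x = 1`. -/
noncomputable def polarPart (z s : ℂ) : ℂ := lambertMain z * (1 / (s - 1)) + z⁻¹ * (1 / (s - 1) ^ 2)

lemma lambertMain_mul_ofReal {z : ℂ} (hz : z ≠ 0) {x : ℝ} (hx : 0 < x) :
    lambertMain (z * x) =
      lambertMain z • (x : ℂ) ^ (-1 : ℂ) - z⁻¹ • (Real.log x • (x : ℂ) ^ (-1 : ℂ)) := by
  have hx0 : (x : ℂ) ≠ 0 := by exact_mod_cast hx.ne'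
  rw [lambertMain, lambertMain, log_mul_ofReal x hx z hz, cpow_neg_one, real_smul, smul_eq_mul,
    smul_eq_mul]
  field_simp
  ring

lemma hasMellin_lambertMain_Ioc {z s : ℂ} (hz : z ≠ 0) (hs : 1 < s.re) :
    HasMellin ((Ioc (0 : ℝ) 1).indicator fun x => lambertMain (z * x)) s (polarPart z s) := by
  obtain ⟨c1, v1⟩ := hasMellin_inv_Ioc hs
  obtain ⟨c2, v2⟩ := hasMellin_log_inv_Ioc hs
  have h := hasMellin_sub (c1.const_smul (lambertMain z)) (c2.const_smul z⁻¹)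
  rw [mellin_const_smul, mellin_const_smul, v1, v2] at h
  have heq : lambertMain z • (1 / (s - 1)) - z⁻¹ • -(1 / (s - 1) ^ 2) = polarPart z s := by
    simp only [smul_eq_mul, polarPart]; ring
  rw [heq] at h
  refine HasMellin.congr_Ioi h fun x hx => ?_
  by_cases hx1 : x ∈ Ioc (0 : ℝ) 1
  · simp only [indicator_of_mem hx1, lambertMain_mul_ofReal hz hx]
  · simp only [indicator_of_notMem hx1, smul_zero, sub_zero]

/-- The sign is opposite to that on `(0, 1]`, in the complementary half plane. Hence subtracting the
leading term on `(1, ∞)` restores exactly the polar part that was split off on `(0, 1]`. -/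
lemma hasMellin_lambertMain_Ioi {z s : ℂ} (hz : z ≠ 0) (hs : s.re < 1) :
    HasMellin ((Ioi (1 : ℝ)).indicator fun x => lambertMain (z * x)) s (-polarPart z s) := by
  obtain ⟨c1, v1⟩ := hasMellin_inv_Ioi hs
  obtain ⟨c2, v2⟩ := hasMellin_log_inv_Ioi hs
  have h := hasMellin_sub (c1.const_smul (lambertMain z)) (c2.const_smul z⁻¹)
  rw [mellin_const_smul, mellin_const_smul, v1, v2] at h
  have heq : lambertMain z • -(1 / (s - 1)) - z⁻¹ • (1 / (s - 1) ^ 2) = -polarPart z s := by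
    simp only [smul_eq_mul, polarPart]; ring
  rw [heq] at h
  refine HasMellin.congr_Ioi h fun x hx => ?_
  by_cases hx1 : x ∈ Ioi (1 : ℝ)
  · simp only [indicator_of_mem hx1, lambertMain_mul_ofReal hz hx]
  · simp only [indicator_of_notMem hx1, smul_zero, sub_zero]

lemma lambertRem_eq (z : ℂ) : lambertRem z = lambert z - lambertMain z := rfl

lemma continuousOn_lambertRem : ContinuousOn lambertRem {z | 0 < z.re} := by
  refine continuousOn_lambert.sub (ContinuousOn.div (continuousOn_const.sub ?_) continuousOn_id ?_)
  · exact fun z hz => (continuousAt_clog (Or.inl hz)).continuousWithinAt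
  · rintro z hz rfl
    simp at hz

lemma mapsTo_ray {z : ℂ} (hz : 0 < z.re) :
    MapsTo (fun x : ℝ => z * x) (Ioi 0) {w : ℂ | 0 < w.re} := fun x hx => by
  change 0 < (z * x).re
  rw [re_mul_ofReal]
  exact mul_pos hz hx

lemma lambertRem_ray_isBigO_zero {z : ℂ} (hz : 0 < z.re) :
    (fun x : ℝ => lambertRem (z * x)) =O[𝓝[>] 0] fun x => x ^ (-0 : ℝ) := by
  obtain ⟨c, hc, hc1, hcz⟩ := exists_sector hz
  have hto : Tendsto (fun x : ℝ => z * x) (𝓝[>] 0) (𝓝[{w | w ≠ 0 ∧ c * ‖w‖ ≤ w.re}] 0) := by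
    refine tendsto_nhdsWithin_iff.mpr ⟨?_, ?_⟩
    · have : Tendsto (fun x : ℝ => z * x) (𝓝 0) (𝓝 (z * (0 : ℝ))) :=
        (by fun_prop : Continuous fun x : ℝ => z * x).tendsto 0
      rw [ofReal_zero, mul_zero] at this
      exact this.mono_left nhdsWithin_le_nhds
    · filter_upwards [self_mem_nhdsWithin] with x hx
      refine ⟨fun h => ?_, norm_mul_ofReal_sector hcz (le_of_lt hx)⟩
      have : 0 < (z * x).re := mapsTo_ray hz hx
      simp [h] at this
  simp only [neg_zero, Real.rpow_zero]
  exact ((tendsto_lambertRem hc hc1).comp hto).isBigO_one ℝ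

lemma lambert_ray_isBigO_atTop {z : ℂ} (hz : 0 < z.re) :
    (fun x : ℝ => lambert (z * x)) =O[atTop] fun x => Real.exp (-z.re * x) := by
  set q := 1 - Real.exp (-z.re)
  have hq : 0 < q := sub_pos.mpr (Real.exp_lt_one_iff.mpr (by linarith))
  refine IsBigO.of_bound (q⁻¹ * q⁻¹) ((eventually_ge_atTop 1).mono fun x hx => ?_)
  have hx0 : 0 < (z * x).re := mapsTo_ray hz (zero_lt_one.trans_le hx)
  have h1 := norm_lambert_le hx0
  have h2 : q ≤ 1 - Real.exp (-(z * x).re) := by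
    have : z.re ≤ (z * x).re := by rw [re_mul_ofReal]; nlinarith
    have := Real.exp_le_exp.mpr (neg_le_neg this)
    linarith
  have h3 : (1 - Real.exp (-(z * x).re))⁻¹ ≤ q⁻¹ := inv_anti₀ hq h2
  have h4 : 0 ≤ (1 - Real.exp (-(z * x).re))⁻¹ := inv_nonneg.mpr (hq.le.trans h2)
  rw [Real.norm_eq_abs, Real.abs_exp]
  calc _ ≤ _ := h1
    _ ≤ Real.exp (-(z * x).re) / q * q⁻¹ := by gcongr
    _ = _ := by rw [re_mul_ofReal, neg_mul]; ring

/-- The function `(s - 1) ζ(s)`, with the correct value at `s = 1`. -/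
noncomputable def zetaReg : ℂ → ℂ := Function.update (fun s => (s - 1) * riemannZeta s) 1 1

lemma zetaReg_of_ne {s : ℂ} (hs : s ≠ 1) : zetaReg s = (s - 1) * riemannZeta s :=
  Function.update_of_ne hs _ _

lemma differentiable_zetaReg : Differentiable ℂ zetaReg := by
  have hne {s : ℂ} (hs : s ≠ 1) : DifferentiableAt ℂ zetaReg s := by
    have : zetaReg =ᶠ[𝓝 s] fun s => (s - 1) * riemannZeta s := by
      filter_upwards [isOpen_ne.mem_nhds hs] with w hw using zetaReg_of_ne hw
    refine this.differentiableAt_iff.mpr ?_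
    exact (differentiableAt_id.sub_const 1).mul (differentiableAt_riemannZeta hs)
  intro s
  rcases eq_or_ne s 1 with rfl | hs
  · refine (analyticAt_of_differentiable_on_punctured_nhds_of_continuousAt ?_ ?_).differentiableAt
    · filter_upwards [self_mem_nhdsWithin] with w hw using hne hw
    · exact continuousAt_update_same.mpr riemannZeta_residue_one
  · exact hne hs

/-- With `f` the remainder on `(0, 1]` and `g` the series on `(1, ∞)`, the sum of their transforms
and `polarPart` is `Γ ζ² z^(-s)` for `Re s > 1`. Both transforms exist for `Re s > 0`, so the
identity continues there, and for `Re s < 1` the polar part is again the transform of a function. -/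
lemma hasMellin_lambertRem {z s : ℂ} (hz : 0 < z.re) (hs0 : 0 < s.re) (hs1 : s.re < 1) :
    HasMellin (fun x : ℝ => lambertRem (z * x)) s (Gamma s * riemannZeta s ^ 2 * z ^ (-s)) := by
  have hz0 : z ≠ 0 := by rintro rfl; simp at hz
  set f : ℝ → ℂ := (Ioc (0 : ℝ) 1).indicator fun x => lambertRem (z * x)
  set g : ℝ → ℂ := (Ioi (1 : ℝ)).indicator fun x => lambert (z * x)
  have hray : ContinuousOn (fun x : ℝ => z * x) (Ioi 0) := by fun_prop
  have hf1 : LocallyIntegrableOn f (Ioi 0) := locallyIntegrableOn_indicator measurableSet_Ioc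
    ((continuousOn_lambertRem.comp hray (mapsTo_ray hz)).locallyIntegrableOn measurableSet_Ioi)
  have hg1 : LocallyIntegrableOn g (Ioi 0) := locallyIntegrableOn_indicator measurableSet_Ioi
    ((continuousOn_lambert.comp hray (mapsTo_ray hz)).locallyIntegrableOn measurableSet_Ioi)
  have hf2 (a : ℝ) : f =O[atTop] (fun x : ℝ => x ^ (-a)) := indicator_Ioc_isBigO_atTop _ _
  have hf3 : f =O[𝓝[>] 0] (fun x : ℝ => x ^ (-0 : ℝ)) :=
    isBigO_indicator (lambertRem_ray_isBigO_zero hz)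
  have hg2 : g =O[atTop] (fun x : ℝ => Real.exp (-z.re * x)) :=
    isBigO_indicator (lambert_ray_isBigO_atTop hz)
  have hg3 (b : ℝ) : g =O[𝓝[>] 0] (fun x : ℝ => x ^ (-b)) := indicator_Ioi_isBigO_zero _ _
  have hfc {w : ℂ} (hw : 0 < w.re) : MellinConvergent f w :=
    mellinConvergent_of_isBigO_rpow hf1 (hf2 (w.re + 1)) (by linarith) hf3 hw
  have hgc (w : ℂ) : MellinConvergent g w :=
    mellinConvergent_of_isBigO_rpow_exp hz hg1 hg2 (hg3 (w.re - 1)) (by linarith)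
  have hsplit {w : ℂ} (hw : 1 < w.re) :
      mellin f w + mellin g w + polarPart z w = Gamma w * riemannZeta w ^ 2 * z ^ (-w) := by
    obtain ⟨c1, v1⟩ := hasMellin_lambertMain_Ioc hz0 hw
    obtain ⟨c2, v2⟩ := hasMellin_add (hfc (zero_lt_one.trans hw)) (hgc w)
    have h3 := hasMellin_add c2 c1
    rw [v1, v2] at h3
    rw [← mellin_lambert hz hw]
    refine (HasMellin.congr_Ioi h3 fun x hx => ?_).2.symm
    simp only [f, g]
    rcases le_or_gt x 1 with hx1 | hx1
    · have m1 : x ∈ Ioc (0 : ℝ) 1 := ⟨hx, hx1⟩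
      have m2 : x ∉ Ioi (1 : ℝ) := not_lt.mpr hx1
      simp only [indicator_of_mem m1, indicator_of_notMem m2, lambertRem_eq]
      ring
    · have m1 : x ∉ Ioc (0 : ℝ) 1 := fun h => absurd h.2 (not_le.mpr hx1)
      simp only [indicator_of_notMem m1, indicator_of_mem (mem_Ioi.mpr hx1), zero_add, add_zero]
  have hne {w : ℂ} (hw : w.re ≠ 1) : w - 1 ≠ 0 := by
    rw [sub_ne_zero]; rintro rfl; simp at hw
  have hpolar {w : ℂ} (hw : w.re ≠ 1) :
      (w - 1) ^ 2 * polarPart z w = lambertMain z * (w - 1) + z⁻¹ := by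
    have := hne hw
    rw [polarPart]; field_simp
  have hopen : IsOpen {w : ℂ | 0 < w.re} := isOpen_lt continuous_const continuous_re
  -- Multiplication by `(w - 1)²` clears the double pole, so the identity theorem can be used on the
  -- whole half plane `Re w > 0`.
  have hE : EqOn (fun w => (w - 1) ^ 2 * (mellin f w + mellin g w) +
        (lambertMain z * (w - 1) + z⁻¹))
      (fun w => Gamma w * zetaReg w ^ 2 * z ^ (-w)) {w : ℂ | 0 < w.re} := by
    refine AnalyticOnNhd.eqOn_of_preconnected_of_eventuallyEq (z₀ := 2)
      (DifferentiableOn.analyticOnNhd (fun w hw => ?_) hopen)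
      (DifferentiableOn.analyticOnNhd (fun w hw => ?_) hopen)
      (convex_halfSpace_re_gt 0).isPreconnected (by simp) ?_
    · have d1 : DifferentiableAt ℂ (mellin f) w :=
        mellin_differentiableAt_of_isBigO_rpow hf1 (hf2 (w.re + 1)) (by linarith) hf3 hw
      have d2 : DifferentiableAt ℂ (mellin g) w :=
        mellin_differentiableAt_of_isBigO_rpow_exp hz hg1 hg2 (hg3 (w.re - 1)) (by linarith)
      exact DifferentiableAt.differentiableWithinAt (by fun_prop)
    · refine DifferentiableAt.differentiableWithinAt (((differentiableAt_Gamma w fun m h => ?_).mul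
        ((differentiable_zetaReg w).pow 2)).mul (differentiableAt_id.neg.const_cpow (Or.inl hz0)))
      have hw' : 0 < w.re := hw
      rw [h] at hw'
      simp at hw'
      linarith [(m.cast_nonneg : (0 : ℝ) ≤ m)]
    · filter_upwards [(isOpen_lt continuous_const continuous_re).mem_nhds
        (by simp : (1 : ℝ) < (2 : ℂ).re)] with w hw
      have hw1 : w.re ≠ 1 := ne_of_gt hw
      rw [← hpolar hw1, ← mul_add, hsplit hw, zetaReg_of_ne (sub_ne_zero.mp (hne hw1))]
      ring
  have hval : mellin f s + mellin g s + polarPart z s = Gamma s * riemannZeta s ^ 2 * z ^ (-s) := by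
    have h := hE hs0
    have hn := hne hs1.ne
    simp only [← hpolar hs1.ne, ← mul_add, zetaReg_of_ne (sub_ne_zero.mp hn)] at h
    refine mul_left_cancel₀ (pow_ne_zero 2 hn) (h.trans ?_)
    ring
  obtain ⟨c1, v1⟩ := hasMellin_lambertMain_Ioi hz0 hs1
  obtain ⟨c2, v2⟩ := hasMellin_add (hfc hs0) (hgc s)
  have h3 := hasMellin_sub c2 c1
  rw [v1, v2, sub_neg_eq_add, hval] at h3
  refine HasMellin.congr_Ioi h3 fun x hx => ?_
  simp only [f, g]
  rcases le_or_gt x 1 with hx1 | hx1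
  · have m1 : x ∈ Ioc (0 : ℝ) 1 := ⟨hx, hx1⟩
    have m2 : x ∉ Ioi (1 : ℝ) := not_lt.mpr hx1
    simp only [indicator_of_mem m1, indicator_of_notMem m2, add_zero, sub_zero]
  · have m1 : x ∉ Ioc (0 : ℝ) 1 := fun h => absurd h.2 (not_le.mpr hx1)
    simp only [indicator_of_notMem m1, indicator_of_mem (mem_Ioi.mpr hx1), zero_add, lambertRem_eq]

/-! ### Growth on the critical line and Mellin inversion -/

/-- The point `1/2 + i t` of the critical line. -/
noncomputable def critPt (t : ℝ) : ℂ := 1 / 2 + I * t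

lemma critPt_re (t : ℝ) : (critPt t).re = 1 / 2 := by simp [critPt]

lemma critPt_im (t : ℝ) : (critPt t).im = t := by simp [critPt]

lemma critPt_ne_one (t : ℝ) : critPt t ≠ 1 := fun h => by
  have := congrArg re h
  rw [critPt_re] at this
  norm_num at this

lemma critPt_ne_neg_nat (t : ℝ) (m : ℕ) : critPt t ≠ -m := fun h => by
  have := congrArg re h
  rw [critPt_re, neg_re, natCast_re] at this
  linarith [(m.cast_nonneg : (0 : ℝ) ≤ m)]

lemma continuous_critPt : Continuous critPt := by unfold critPt; fun_prop

lemma continuous_zeta_critPt : Continuous fun t => riemannZeta (critPt t) :=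
  continuous_iff_continuousAt.mpr fun t =>
    (differentiableAt_riemannZeta (critPt_ne_one t)).continuousAt.comp continuous_critPt.continuousAt

/-- `Γ(s) ζ(s)²` on the critical line. -/
noncomputable def gammaZetaSq (t : ℝ) : ℂ := Gamma (critPt t) * riemannZeta (critPt t) ^ 2

lemma continuous_gammaZetaSq : Continuous gammaZetaSq :=
  (continuous_iff_continuousAt.mpr fun t =>
    (differentiableAt_Gamma _ (critPt_ne_neg_nat t)).continuousAt.comp
      continuous_critPt.continuousAt).mul (continuous_zeta_critPt.pow 2)

lemma exists_norm_gammaZetaSq_mul_cpow_le {z : ℂ} (hz : 0 < z.re) :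
    ∃ C : ℝ, 0 ≤ C ∧ ∀ t : ℝ, ‖gammaZetaSq t * z ^ (-critPt t)‖ ≤ C := by
  refine ⟨∫ x in Ioi (0 : ℝ), x ^ (-(1 / 2) : ℝ) * ‖lambertRem (z * x)‖,
    setIntegral_nonneg measurableSet_Ioi fun x hx => by
      have : (0 : ℝ) < x := hx
      positivity, fun t => ?_⟩
  have h := (hasMellin_lambertRem (s := critPt t) hz (by rw [critPt_re]; norm_num)
    (by rw [critPt_re]; norm_num)).2
  rw [gammaZetaSq, ← h]
  refine (norm_integral_le_integral_norm _).trans (le_of_eq ?_)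
  refine setIntegral_congr_fun measurableSet_Ioi fun x hx => ?_
  simp only [norm_smul]
  rw [norm_cpow_eq_rpow_re_of_pos hx, sub_re, critPt_re, one_re]
  norm_num

/-- Take `z = exp(iθ)`: then `|z^(-s)| = exp(θ t)`, while the Mellin integral is bounded
independently of `t`. This gives the decay without Stirling's formula or a growth bound for `ζ`. -/
lemma exists_norm_gammaZetaSq_le_exp {θ : ℝ} (hθ : |θ| < Real.pi / 2) :
    ∃ C : ℝ, 0 ≤ C ∧ ∀ t : ℝ, ‖gammaZetaSq t‖ ≤ C * Real.exp (-(θ * t)) := by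
  have hθ' := abs_lt.mp hθ
  have hz : 0 < (exp (θ * I)).re := by
    rw [exp_ofReal_mul_I_re]
    exact Real.cos_pos_of_mem_Ioo ⟨by linarith, by linarith⟩
  obtain ⟨C, hC0, hC⟩ := exists_norm_gammaZetaSq_mul_cpow_le hz
  refine ⟨C, hC0, fun t => ?_⟩
  have h := hC t
  have harg : arg (exp (θ * I)) = θ := by
    rw [arg_exp_mul_I]
    refine (toIocMod_eq_self _).mpr ⟨?_, ?_⟩ <;> linarith [Real.pi_pos]
  rw [norm_mul, norm_cpow_of_ne_zero (exp_ne_zero _), harg, norm_exp_ofReal_mul_I, Real.one_rpow,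
    neg_im, critPt_im, one_div, ← Real.exp_neg] at h
  have h2 : Real.exp (-(θ * -t)) * Real.exp (-(θ * t)) = 1 := by
    rw [← Real.exp_add]; simp
  calc ‖gammaZetaSq t‖ = ‖gammaZetaSq t‖ * Real.exp (-(θ * -t)) * Real.exp (-(θ * t)) := by
        rw [mul_assoc, h2, mul_one]
    _ ≤ _ := by gcongr

lemma exists_norm_gammaZetaSq_le_exp_abs {θ : ℝ} (hθ0 : 0 ≤ θ) (hθ : θ < Real.pi / 2) :
    ∃ C : ℝ, 0 ≤ C ∧ ∀ t : ℝ, ‖gammaZetaSq t‖ ≤ C * Real.exp (-(θ * |t|)) := by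
  obtain ⟨C1, h10, h1⟩ := exists_norm_gammaZetaSq_le_exp (θ := θ) (by rwa [abs_of_nonneg hθ0])
  obtain ⟨C2, h20, h2⟩ := exists_norm_gammaZetaSq_le_exp (θ := -θ) (by rwa [abs_neg, abs_of_nonneg hθ0])
  refine ⟨C1 + C2, by positivity, fun t => ?_⟩
  rcases le_total 0 t with ht | ht
  · rw [abs_of_nonneg ht]
    refine (h1 t).trans ?_
    gcongr
    linarith
  · rw [abs_of_nonpos ht, mul_neg, ← neg_mul]
    refine (h2 t).trans ?_
    gcongr
    linarith

lemma integrable_exp_neg_mul_abs {ε : ℝ} (hε : 0 < ε) :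
    Integrable fun t : ℝ => Real.exp (-(ε * |t|)) := by
  rw [← integrableOn_univ, ← Iic_union_Ioi (a := (0 : ℝ))]
  refine IntegrableOn.union ?_ ?_
  · refine (integrableOn_exp_mul_Iic hε 0).congr_fun (fun t ht => ?_) measurableSet_Iic
    simp only [abs_of_nonpos (mem_Iic.mp ht), mul_neg, neg_neg]
  · refine (integrableOn_exp_mul_Ioi (neg_neg_of_pos hε) 0).congr_fun (fun t ht => ?_)
      measurableSet_Ioi
    simp only [abs_of_pos (mem_Ioi.mp ht), neg_mul]

/-- The weight `|ζ(1/2 + i t)|²`. -/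
noncomputable def zetaSq (t : ℝ) : ℂ := ((‖riemannZeta (critPt t)‖ ^ 2 : ℝ) : ℂ)

lemma continuous_zetaSq : Continuous zetaSq := by
  have := continuous_zeta_critPt
  unfold zetaSq
  fun_prop

lemma one_sub_critPt (t : ℝ) : 1 - critPt t = (starRingEnd ℂ) (critPt t) := by
  refine Complex.ext ?_ ?_ <;> simp [critPt]
  norm_num

lemma zetaSq_neg (t : ℝ) : zetaSq (-t) = zetaSq t := by
  have : critPt (-t) = (starRingEnd ℂ) (critPt t) := by
    refine Complex.ext ?_ ?_ <;> simp [critPt]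
  simp only [zetaSq, this, riemannZeta_conj, RCLike.norm_conj]

lemma zetaSq_eq (t : ℝ) : zetaSq t =
    gammaZetaSq t * (2 * (2 * Real.pi : ℂ) ^ (-critPt t) * cos (Real.pi * critPt t / 2)) := by
  have h := riemannZeta_one_sub (critPt_ne_neg_nat t) (critPt_ne_one t)
  rw [one_sub_critPt, riemannZeta_conj] at h
  have h2 := Complex.conj_mul' (riemannZeta (critPt t))
  rw [zetaSq, ofReal_pow, ← h2, h, gammaZetaSq]
  ring

/-- Puts the power in the same exponential form as `rotLog`, so that the factors of the rotated
integrand combine by adding exponents. -/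
lemma two_pi_cpow (s : ℂ) : (2 * Real.pi : ℂ) ^ s = exp (s * Real.log (2 * Real.pi)) := by
  have h0 : (2 * Real.pi : ℂ) ≠ 0 := by
    exact_mod_cast (by positivity : (2 * Real.pi : ℝ) ≠ 0)
  rw [cpow_def_of_ne_zero h0, mul_comm, ofReal_log (by positivity)]
  push_cast
  rfl

lemma two_cos_half_pi_critPt (t : ℝ) : 2 * cos (Real.pi * critPt t / 2) =
    exp (-(Real.pi * I / 2 * critPt t)) * (1 + I * exp (-(Real.pi * t))) := by
  have h (w : ℂ) : I * w = exp (Real.pi / 2 * I) * w := by rw [exp_pi_div_two_mul_I]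
  rw [mul_add, mul_one, h, ← Complex.exp_add, ← Complex.exp_add, Complex.cos,
    mul_div_cancel₀ _ two_ne_zero, add_comm]
  congr 2
  · ring
  · simp only [critPt]
    ring_nf
    simp only [I_sq]
    ring

lemma norm_zetaSq_le (t : ℝ) :
    ‖zetaSq t‖ ≤ 2 * (‖gammaZetaSq t‖ * Real.exp (Real.pi / 2 * |t|)) := by
  have h1 : ‖(2 * Real.pi : ℂ) ^ (-critPt t)‖ ≤ 1 := by
    have := norm_cpow_eq_rpow_re_of_pos (by positivity : (0 : ℝ) < 2 * Real.pi) (-critPt t)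
    push_cast at this
    rw [this, neg_re, critPt_re]
    exact Real.rpow_le_one_of_one_le_of_nonpos (by linarith [Real.pi_gt_three]) (by norm_num)
  have h2 : ‖2 * cos (Real.pi * critPt t / 2)‖ ≤ 2 * Real.exp (Real.pi / 2 * |t|) := by
    rw [Complex.cos, mul_div_cancel₀ _ two_ne_zero, two_mul]
    have him : (Real.pi * critPt t / 2 * I).re = -(Real.pi / 2 * t) := by
      simp [critPt]; ring
    refine (norm_add_le _ _).trans (add_le_add ?_ ?_) <;> rw [Complex.norm_exp]
    · rw [him, Real.exp_le_exp, ← mul_neg]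
      have := neg_le_abs t
      gcongr
    · rw [neg_mul, neg_re, him, neg_neg, Real.exp_le_exp]
      have := le_abs_self t
      gcongr
  rw [zetaSq_eq, norm_mul, mul_comm (2 : ℂ), mul_assoc, norm_mul]
  calc _ ≤ ‖gammaZetaSq t‖ * (1 * (2 * Real.exp (Real.pi / 2 * |t|))) := by gcongr
    _ = _ := by ring

/-- The cosine in the functional equation grows like `exp(π|t|/2)`, and `gammaZetaSq` decays at any
rate below `π/2`. This subexponential bound is what makes the damped mean square converge. -/
lemma exists_norm_zetaSq_le {ε : ℝ} (hε : 0 < ε) :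
    ∃ C : ℝ, 0 ≤ C ∧ ∀ t : ℝ, ‖zetaSq t‖ ≤ C * Real.exp (ε * |t|) := by
  have hpi := Real.pi_pos
  set θ := max 0 (Real.pi / 2 - ε)
  obtain ⟨C, hC0, hC⟩ := exists_norm_gammaZetaSq_le_exp_abs (θ := θ) (le_max_left _ _)
    (max_lt (by positivity) (by linarith))
  refine ⟨2 * C, by positivity, fun t => (norm_zetaSq_le t).trans ?_⟩
  rw [mul_assoc]
  refine mul_le_mul_of_nonneg_left ?_ zero_le_two
  calc _ ≤ C * Real.exp (-(θ * |t|)) * Real.exp (Real.pi / 2 * |t|) :=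
        mul_le_mul_of_nonneg_right (hC t) (Real.exp_pos _).le
    _ ≤ _ := by
      rw [mul_assoc, ← Real.exp_add]
      refine mul_le_mul_of_nonneg_left (Real.exp_le_exp.mpr ?_) hC0
      have : Real.pi / 2 - ε ≤ θ := le_max_right _ _
      nlinarith [abs_nonneg t]

lemma integral_gammaZetaSq_mul_cpow {z : ℂ} (hz : 0 < z.re) :
    Integrable (fun t : ℝ => gammaZetaSq t * z ^ (-critPt t)) ∧
      ∫ t : ℝ, gammaZetaSq t * z ^ (-critPt t) = 2 * Real.pi * lambertRem z := by
  have hz0 : z ≠ 0 := by rintro rfl; simp at hz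
  have hpi := Real.pi_pos
  have harg : |arg z| < Real.pi / 2 := abs_arg_lt_pi_div_two_iff.mpr (Or.inl hz)
  -- `z^(-s)` grows at most like `exp(|arg z| |t|)`; a decay rate `θ` strictly above `|arg z|` gives
  -- integrability.
  obtain ⟨θ, hθ1, hθ2⟩ := exists_between harg
  have hint : Integrable (fun t : ℝ => gammaZetaSq t * z ^ (-critPt t)) := by
    obtain ⟨C, hC0, hC⟩ := exists_norm_gammaZetaSq_le_exp_abs ((abs_nonneg _).trans hθ1.le) hθ2
    refine ((integrable_exp_neg_mul_abs (sub_pos.mpr hθ1)).const_mul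
      (C * ‖z‖ ^ (-(1 / 2) : ℝ))).mono' ?_ (Eventually.of_forall fun t => ?_)
    · refine (continuous_gammaZetaSq.mul ?_).aestronglyMeasurable
      exact continuous_critPt.neg.const_cpow (Or.inl hz0)
    · rw [norm_mul, norm_cpow_of_ne_zero hz0, neg_re, critPt_re, neg_im, critPt_im, mul_neg,
        Real.exp_neg, div_inv_eq_mul]
      have h1 : Real.exp (arg z * t) ≤ Real.exp (|arg z| * |t|) := by
        rw [Real.exp_le_exp, ← abs_mul]; exact le_abs_self _
      calc _ ≤ C * Real.exp (-(θ * |t|)) * (‖z‖ ^ (-(1 / 2) : ℝ) * Real.exp (|arg z| * |t|)) := by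
            gcongr; exact hC t
        _ = C * ‖z‖ ^ (-(1 / 2) : ℝ) * (Real.exp (-(θ * |t|)) * Real.exp (|arg z| * |t|)) := by ring
        _ = _ := by rw [← Real.exp_add]; ring_nf
  refine ⟨hint, ?_⟩
  have hpt (t : ℝ) : (((1 / 2 : ℝ) : ℂ) + t * I) = critPt t := by
    rw [critPt]; push_cast; ring
  have hm (t : ℝ) := hasMellin_lambertRem (s := critPt t) hz (by rw [critPt_re]; norm_num)
    (by rw [critPt_re]; norm_num)
  -- Inversion is needed only at `x = 1`, since `z` already carries the variable.
  have hinv := mellinInv_mellin_eq (1 / 2) (fun x : ℝ => lambertRem (z * x)) zero_lt_one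
    (hasMellin_lambertRem hz (by simp) (by simp; norm_num)).1 ?_ ?_
  · rw [mellinInv] at hinv
    simp only [hpt, (hm _).2, ofReal_one, one_cpow, one_smul, mul_one] at hinv
    rw [← hinv, real_smul]
    have : (Real.pi : ℂ) ≠ 0 := by exact_mod_cast hpi.ne'
    push_cast
    field_simp
    rfl
  · unfold VerticalIntegrable
    simp only [hpt, (hm _).2]
    exact hint
  · have := continuousOn_lambertRem.comp (by fun_prop : ContinuousOn (fun x : ℝ => z * x) (Ioi 0))
      (mapsTo_ray hz)
    exact this.continuousAt (Ioi_mem_nhds zero_lt_one)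

/-! ### Rotation towards the imaginary axis -/

/-- The point `2 π i exp (-i δ)`, as the exponential of its logarithm. -/
noncomputable def rotLog (δ : ℂ) : ℂ := Real.log (2 * Real.pi) + Real.pi * I / 2 - I * δ

lemma rotLog_im (δ : ℂ) : (rotLog δ).im = Real.pi / 2 - δ.re := by
  simp [rotLog]

lemma exp_rotLog (δ : ℂ) : exp (rotLog δ) = 2 * Real.pi * I * exp (-(I * δ)) := by
  rw [rotLog, sub_eq_add_neg, Complex.exp_add, Complex.exp_add, ← ofReal_exp,
    Real.exp_log (by positivity), show (Real.pi * I / 2 : ℂ) = Real.pi / 2 * I by ring,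
    exp_pi_div_two_mul_I]
  push_cast
  rfl

lemma log_exp_rotLog {δ : ℂ} (h0 : 0 < δ.re) (h1 : δ.re < Real.pi) :
    log (exp (rotLog δ)) = rotLog δ := by
  refine log_exp ?_ ?_ <;> rw [rotLog_im] <;> linarith [Real.pi_pos]

/-- The argument is `π/2 - Re δ`: the point lies in the right half plane and approaches the
imaginary axis as `δ → 0`. -/
lemma re_exp_rotLog_pos {δ : ℂ} (h0 : 0 < δ.re) (h1 : δ.re < Real.pi) :
    0 < (exp (rotLog δ)).re := by
  rw [exp_re, rotLog_im]
  exact mul_pos (Real.exp_pos _) (Real.cos_pos_of_mem_Ioo ⟨by linarith, by linarith⟩)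

lemma one_add_I_mul_exp_ne_zero (t : ℝ) : 1 + I * exp (-(Real.pi * t)) ≠ 0 := fun h => by
  have h2 : (1 + I * exp (-(Real.pi * t))).re = 1 := by
    rw [show (-(Real.pi * t) : ℂ) = ((-(Real.pi * t) : ℝ) : ℂ) by push_cast; rfl, ← ofReal_exp,
      add_re, I_mul_re, ofReal_im]
    simp
  rw [h] at h2
  simp at h2

lemma rotated_integrand (δ : ℂ) {t : ℝ} (h0 : 0 < δ.re) (h1 : δ.re < Real.pi) :
    exp (-(I * δ / 2)) * (gammaZetaSq t * exp (rotLog δ) ^ (-critPt t)) =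
      zetaSq t * exp (-δ * t) / (1 + I * exp (-(Real.pi * t))) := by
  rw [eq_div_iff (one_add_I_mul_exp_ne_zero t), zetaSq_eq, cpow_def_of_ne_zero (exp_ne_zero _),
    log_exp_rotLog h0 h1, two_pi_cpow]
  have h2 : 2 * exp (-critPt t * Real.log (2 * Real.pi)) * cos (Real.pi * critPt t / 2) =
      exp (-critPt t * Real.log (2 * Real.pi)) * (exp (-(Real.pi * I / 2 * critPt t)) *
        (1 + I * exp (-(Real.pi * t)))) := by
    rw [← two_cos_half_pi_critPt]; ring
  have h3 : exp (-(I * δ / 2)) * exp (rotLog δ * -critPt t) =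
      exp (-critPt t * Real.log (2 * Real.pi)) * exp (-(Real.pi * I / 2 * critPt t)) *
        exp (-δ * t) := by
    rw [← Complex.exp_add, ← Complex.exp_add, ← Complex.exp_add]
    congr 1
    simp only [rotLog, critPt]
    ring_nf
    simp only [I_sq]
    ring
  rw [h2]
  linear_combination (gammaZetaSq t * (1 + I * exp (-(Real.pi * t)))) * h3

/-- The closed form of the rotated mean square. -/
noncomputable def rotatedMean (δ : ℂ) : ℂ :=
  2 * Real.pi * exp (-(I * δ / 2)) * lambertRem (exp (rotLog δ))

lemma integral_rotated {δ : ℂ} (h0 : 0 < δ.re) (h1 : δ.re < Real.pi) :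
    Integrable (fun t : ℝ => zetaSq t * exp (-δ * t) / (1 + I * exp (-(Real.pi * t)))) ∧
      ∫ t : ℝ, zetaSq t * exp (-δ * t) / (1 + I * exp (-(Real.pi * t))) = rotatedMean δ := by
  obtain ⟨hi, hv⟩ := integral_gammaZetaSq_mul_cpow (re_exp_rotLog_pos h0 h1)
  simp_rw [← rotated_integrand δ h0 h1]
  refine ⟨hi.const_mul _, ?_⟩
  rw [integral_const_mul, hv, rotatedMean]
  ring

lemma integrableOn_zetaSq_mul_exp {δ : ℂ} (hδ : 0 < δ.re) :
    IntegrableOn (fun t : ℝ => zetaSq t * exp (-δ * t)) (Ioi 0) := by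
  obtain ⟨C, hC0, hC⟩ := exists_norm_zetaSq_le (half_pos hδ)
  refine Integrable.mono' ((integrableOn_exp_mul_Ioi (a := -(δ.re / 2)) (by linarith) 0).const_mul C)
    ((continuous_zetaSq.mul (by fun_prop)).aestronglyMeasurable)
    ((ae_restrict_iff' measurableSet_Ioi).mpr (Eventually.of_forall fun t ht => ?_))
  rw [norm_mul, Complex.norm_exp, re_mul_ofReal, neg_re]
  calc _ ≤ C * Real.exp (δ.re / 2 * |t|) * Real.exp (-δ.re * t) := by gcongr; exact hC t
    _ = _ := by
      rw [abs_of_pos ht, mul_assoc, ← Real.exp_add]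
      ring_nf

/-! ### Symmetrisation and the Fermi weight -/

/-- The Fermi weight `exp (-2 π t) / (1 + exp (-2 π t))`. -/
noncomputable def fermi (t : ℝ) : ℝ :=
  Real.exp (-(2 * Real.pi) * t) / (1 + Real.exp (-(2 * Real.pi) * t))

lemma continuous_fermi : Continuous fermi := by
  unfold fermi
  refine Continuous.div (by fun_prop) (by fun_prop) fun t => ?_
  positivity

lemma fermi_nonneg (t : ℝ) : 0 ≤ fermi t := by unfold fermi; positivity

lemma fermi_le (t : ℝ) : fermi t ≤ Real.exp (-(2 * Real.pi) * t) :=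
  div_le_self (Real.exp_pos _).le (by linarith [Real.exp_pos (-(2 * Real.pi) * t)])

lemma one_sub_fermi_neg (t : ℝ) : 1 - fermi (-t) = fermi t := by
  have h := Real.exp_pos (-(2 * Real.pi) * t)
  rw [fermi, fermi, mul_neg, Real.exp_neg]
  field_simp
  ring

/-- With `E = exp(-πt)`, the mean of `1/(1 + iE)` and `1/(1 - iE)` is `1/(1 + E²)`. Conjugating `δ`
before conjugating the value keeps the factor `exp(-δt)` intact for complex `δ`. -/
lemma rotated_add_conj (δ : ℂ) (t : ℝ) :
    (zetaSq t * exp (-δ * t) / (1 + I * exp (-(Real.pi * t))) +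
      conj (zetaSq t * exp (-(conj δ) * t) / (1 + I * exp (-(Real.pi * t))))) / 2 =
      zetaSq t * exp (-δ * t) * (1 - fermi t : ℝ) := by
  have hE : exp (-(Real.pi * t)) = ((Real.exp (-(Real.pi * t)) : ℝ) : ℂ) := by push_cast; rfl
  have hne := one_add_I_mul_exp_ne_zero t
  have hne' : 1 - I * exp (-(Real.pi * t)) ≠ 0 := by
    intro h
    apply hne
    have := congrArg conj h
    rw [hE] at this ⊢
    simpa [-ofReal_exp] using this
  have hconj : conj (zetaSq t * exp (-(conj δ) * t) / (1 + I * exp (-(Real.pi * t)))) =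
      zetaSq t * exp (-δ * t) / (1 - I * exp (-(Real.pi * t))) := by
    rw [hE]
    simp [-ofReal_exp, zetaSq, ← exp_conj, sub_eq_add_neg]
  have hsq : Real.exp (-(2 * Real.pi) * t) = Real.exp (-(Real.pi * t)) ^ 2 := by
    rw [← Real.exp_nat_mul]; push_cast; ring_nf
  have hF : ((1 - fermi t : ℝ) : ℂ) = 1 / (1 + exp (-(Real.pi * t)) ^ 2) := by
    have h : 1 - fermi t = 1 / (1 + Real.exp (-(Real.pi * t)) ^ 2) := by
      rw [fermi, hsq]
      have : 0 < 1 + Real.exp (-(Real.pi * t)) ^ 2 := by positivity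
      field_simp
      ring
    rw [h]; push_cast; rfl
  have hprod : (1 + exp (-(Real.pi * t)) ^ 2 : ℂ) =
      (1 + I * exp (-(Real.pi * t))) * (1 - I * exp (-(Real.pi * t))) := by
    linear_combination (exp (-(Real.pi * t)) ^ 2) * I_sq
  rw [hconj, hF, hprod]
  clear hE hconj hF hprod
  generalize exp (-(Real.pi * t)) = E at *
  field_simp
  ring

/-- The exponentially damped correction between the one-sided and the symmetrised mean squares. -/
noncomputable def fermiCorrection (δ : ℂ) : ℂ :=
  ∫ t in Ioi (0 : ℝ), zetaSq t * (exp (δ * t) - exp (-δ * t)) * (fermi t : ℝ)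

/-- Fold the line at `0`: `|ζ|²` is even and `1 - fermi(-t) = fermi t`, so the negative half
contributes `exp(δt) · fermi t`, while the positive half lacks `exp(-δt) · fermi t`. -/
lemma symmetrized_rotatedMean {δ : ℂ} (h0 : 0 < δ.re) (h1 : δ.re < Real.pi) :
    (rotatedMean δ + conj (rotatedMean (conj δ))) / 2 =
      (∫ t in Ioi (0 : ℝ), zetaSq t * exp (-δ * t)) + fermiCorrection δ := by
  obtain ⟨i1, v1⟩ := integral_rotated h0 h1
  obtain ⟨i2, v2⟩ := integral_rotated (δ := conj δ) (by simpa using h0) (by simpa using h1)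
  set k : ℝ → ℂ := fun t => zetaSq t * exp (-δ * t) * (1 - fermi t : ℝ)
  have i2' : Integrable fun t : ℝ =>
      conj (zetaSq t * exp (-(conj δ) * t) / (1 + I * exp (-(Real.pi * t)))) :=
    (LinearIsometryEquiv.integrable_comp_iff conjLIE).mpr i2
  have hk : Integrable k := by
    refine ((i1.add i2').div_const 2).congr (Eventually.of_forall fun t => ?_)
    exact rotated_add_conj δ t
  have hkv : ∫ t, k t = (rotatedMean δ + conj (rotatedMean (conj δ))) / 2 := by
    rw [← v1, ← v2, ← integral_conj, ← integral_add i1 i2', ← integral_div]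
    exact integral_congr_ae (Eventually.of_forall fun t => (rotated_add_conj δ t).symm)
  have hneg : IntegrableOn (fun t => k (-t)) (Ioi 0) := hk.comp_neg.integrableOn
  have hW := integrableOn_zetaSq_mul_exp h0
  have hpt (t : ℝ) : k t + k (-t) - zetaSq t * exp (-δ * t) =
      zetaSq t * (exp (δ * t) - exp (-δ * t)) * (fermi t : ℝ) := by
    simp only [k, one_sub_fermi_neg, zetaSq_neg]
    rw [← neg_neg t, one_sub_fermi_neg, ← one_sub_fermi_neg (- -t), neg_neg]
    push_cast
    rw [show -δ * -(t : ℂ) = δ * t by ring]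
    have := one_sub_fermi_neg (-t)
    rw [neg_neg] at this
    have h2 : (fermi (-t) : ℂ) = 1 - fermi t := by rw [← this]; push_cast; ring
    rw [h2]
    ring
  rw [← hkv, ← intervalIntegral.integral_Iic_add_Ioi hk.integrableOn hk.integrableOn (b := 0)]
  have h2 := integral_comp_neg_Ioi (0 : ℝ) k
  rw [neg_zero] at h2
  rw [← h2, fermiCorrection, ← integral_add hneg hk.integrableOn]
  simp_rw [← hpt]
  have h3 := integral_sub (f := fun t => k t + k (-t)) (hk.integrableOn.add hneg) hW
  rw [h3, add_sub_cancel]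
  simp_rw [add_comm]

lemma tendsto_fermiCorrection : Tendsto fermiCorrection (𝓝 0) (𝓝 0) := by
  obtain ⟨C, hC0, hC⟩ := exists_norm_zetaSq_le zero_lt_one
  have hpi := Real.pi_gt_three
  have h := tendsto_integral_filter_of_dominated_convergence (μ := volume.restrict (Ioi (0 : ℝ)))
    (l := 𝓝 (0 : ℂ)) (F := fun (δ : ℂ) (t : ℝ) =>
      zetaSq t * (exp (δ * t) - exp (-δ * t)) * (fermi t : ℝ)) (f := fun _ => 0)
    -- For `‖δ‖ ≤ 1` the exponentials contribute `2 exp t`, the zeta factor `C exp t`, and the Fermi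
    -- weight `exp(-2πt)`.
    (fun t => 2 * C * Real.exp ((2 - 2 * Real.pi) * t)) ?_ ?_ ?_ ?_
  · rw [integral_zero] at h
    exact h
  · refine Eventually.of_forall fun δ => Continuous.aestronglyMeasurable ?_
    have := continuous_fermi
    have := continuous_zetaSq
    fun_prop
  · filter_upwards [Metric.closedBall_mem_nhds (0 : ℂ) one_pos] with δ hδ
    rw [mem_closedBall_zero_iff] at hδ
    refine (ae_restrict_iff' measurableSet_Ioi).mpr (Eventually.of_forall fun t ht => ?_)
    have ht0 : 0 < t := ht
    have hexp (w : ℂ) (hw : ‖w‖ ≤ 1) : ‖exp (w * t)‖ ≤ Real.exp t := by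
      rw [Complex.norm_exp, re_mul_ofReal, Real.exp_le_exp]
      have := (le_abs_self _).trans ((abs_re_le_norm w).trans hw)
      nlinarith
    have h1 : ‖exp (δ * t) - exp (-δ * t)‖ ≤ 2 * Real.exp t := by
      refine (norm_sub_le _ _).trans ?_
      linarith [hexp δ hδ, hexp (-δ) (by rwa [norm_neg])]
    have h2 : ‖((fermi t : ℝ) : ℂ)‖ ≤ Real.exp (-(2 * Real.pi) * t) := by
      rw [norm_real, Real.norm_eq_abs, abs_of_nonneg (fermi_nonneg t)]
      exact fermi_le t
    have h3 := hC t
    rw [one_mul, abs_of_pos ht0] at h3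
    rw [norm_mul, norm_mul]
    calc _ ≤ C * Real.exp t * (2 * Real.exp t) * Real.exp (-(2 * Real.pi) * t) := by gcongr
      _ = 2 * C * (Real.exp t * Real.exp t * Real.exp (-(2 * Real.pi) * t)) := by ring
      _ = _ := by
        rw [← Real.exp_add, ← Real.exp_add]
        ring_nf
  · exact (integrableOn_exp_mul_Ioi (by linarith) 0).const_mul _
  · refine Eventually.of_forall fun t => ?_
    have : Continuous fun δ : ℂ =>
      zetaSq t * (exp (δ * t) - exp (-δ * t)) * (fermi t : ℝ) := by fun_prop
    simpa using! this.tendsto 0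

/-! ### Laplace transform of the logarithmic main term -/

/-- The Laplace transform of `2 γ + log (t / 2π)`. -/
noncomputable def logLaplace (δ : ℂ) : ℂ :=
  (Real.eulerMascheroniConstant - Real.log (2 * Real.pi) - log δ) / δ

lemma integral_log_mul_exp {δ : ℂ} (hδ : 0 < δ.re) :
    IntegrableOn (fun t : ℝ =>
      ((2 * Real.eulerMascheroniConstant + Real.log (t / (2 * Real.pi)) : ℝ) : ℂ)
        * exp (-δ * t)) (Ioi 0) ∧
    ∫ t in Ioi (0 : ℝ),
      ((2 * Real.eulerMascheroniConstant + Real.log (t / (2 * Real.pi)) : ℝ) : ℂ)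
        * exp (-δ * t) = logLaplace δ := by
  have hδ0 : δ ≠ 0 := by rintro rfl; simp at hδ
  have hcont : Continuous fun x : ℝ => exp (-(δ * x)) := by fun_prop
  have htop : (fun x : ℝ => exp (-(δ * x))) =O[atTop] fun x : ℝ => x ^ (-2 : ℝ) := by
    refine IsBigO.trans ?_ (isLittleO_exp_neg_mul_rpow_atTop hδ (-2)).isBigO
    exact IsBigO.of_norm_le fun x => by simp [Complex.norm_exp]
  have hbot : (fun x : ℝ => exp (-(δ * x))) =O[𝓝[>] 0] fun x : ℝ => x ^ (-0 : ℝ) := by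
    simp only [neg_zero, Real.rpow_zero]
    exact ((hcont.tendsto 0).isBigO_one ℝ).mono nhdsWithin_le_nhds
  obtain ⟨c1, d1⟩ := mellin_hasDerivAt_of_isBigO_rpow (s := 1)
    (hcont.continuousOn.locallyIntegrableOn measurableSet_Ioi) htop (by simp) hbot (by simp)
  -- The logarithm comes from differentiating `Γ(s) δ^(-s)` at `s = 1`, where `Γ' = -γ`.
  have d2 : HasDerivAt (fun s : ℂ => Gamma s * δ ^ (-s))
      (-Real.eulerMascheroniConstant * δ ^ (-1 : ℂ) + Gamma 1 * (δ ^ (-1 : ℂ) * log δ * -1)) 1 :=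
    Complex.hasDerivAt_Gamma_one.mul ((hasDerivAt_neg (1 : ℂ)).const_cpow (Or.inl hδ0))
  have hm : mellin (fun x : ℝ => Real.log x • exp (-(δ * x))) 1 =
      -(Real.eulerMascheroniConstant + log δ) / δ := by
    have h := d1.unique (d2.congr_of_eventuallyEq ?_)
    · rw [h, Gamma_one, cpow_neg_one]
      field_simp
      ring
    · filter_upwards [(isOpen_lt continuous_const continuous_re).mem_nhds
        (by simp : (0 : ℝ) < (1 : ℂ).re)] with w hw
      exact mellin_exp_neg_mul hδ hw
  have c0 := mellinConvergent_exp_neg_mul hδ (s := 1) (by simp)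
  have v0 := mellin_exp_neg_mul hδ (s := 1) (by simp)
  rw [Gamma_one, cpow_neg_one, one_mul] at v0
  have h := hasMellin_add
    (c0.const_smul (2 * Real.eulerMascheroniConstant - Real.log (2 * Real.pi) : ℂ)) c1
  rw [mellin_const_smul, v0, hm] at h
  have h2 := HasMellin.congr_Ioi (g := fun t : ℝ =>
      ((2 * Real.eulerMascheroniConstant + Real.log (t / (2 * Real.pi)) : ℝ) : ℂ)
        * exp (-δ * t)) h fun t ht => by
    rw [Real.log_div ht.ne' (by positivity), smul_eq_mul, real_smul, neg_mul]
    push_cast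
    ring
  obtain ⟨h3, h4⟩ := h2
  simp only [MellinConvergent, mellin, sub_self, cpow_zero, one_smul] at h3 h4
  refine ⟨h3, h4.trans ?_⟩
  rw [logLaplace, smul_eq_mul]
  ring

/-! ### Limits in sectors -/

/-- The sector of nonzero `z` with `c |z| ≤ Re z`. -/
def sector (c : ℝ) : Set ℂ := {z | z ≠ 0 ∧ c * ‖z‖ ≤ z.re}

lemma re_pos_of_mem_sector {c : ℝ} (hc : 0 < c) {z : ℂ} (hz : z ∈ sector c) : 0 < z.re :=
  (mul_pos hc (norm_pos_iff.mpr hz.1)).trans_le hz.2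

lemma mul_mem_sector_half {c : ℝ} {z u : ℂ} (hc : 0 < c) (hc1 : c ≤ 1) (hz : z ∈ sector c)
    (hu : ‖u - 1‖ ≤ c / 4) : z * u ∈ sector (c / 2) := by
  have hzn : 0 < ‖z‖ := norm_pos_iff.mpr hz.1
  have h1 : ‖z * u - z‖ ≤ ‖z‖ * (c / 4) := by
    rw [← mul_sub_one, norm_mul]; gcongr
  have h2 : z.re - ‖z‖ * (c / 4) ≤ (z * u).re := by
    have := (abs_re_le_norm (z * u - z)).trans h1
    rw [sub_re, abs_le] at this
    linarith
  have h3 : ‖z * u‖ ≤ ‖z‖ + ‖z‖ * (c / 4) := by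
    have := norm_sub_norm_le (z * u) z
    linarith
  have h4 := hz.2
  have h5 : c / 2 * ‖z * u‖ ≤ (z * u).re := by
    have : c / 2 * ‖z * u‖ ≤ c / 2 * (‖z‖ + ‖z‖ * (c / 4)) := by gcongr
    have hcc : c * c ≤ c := by nlinarith
    nlinarith
  refine ⟨?_, h5⟩
  refine mul_ne_zero hz.1 ?_
  rintro rfl
  simp at hu
  linarith

lemma tendsto_mul_log : Tendsto (fun z : ℂ => z * log z) (𝓝 0) (𝓝 0) := by
  rw [tendsto_zero_iff_norm_tendsto_zero]
  have h1 : Tendsto (fun x : ℝ => |Real.log x * x| + x * Real.pi) (𝓝 0) (𝓝 0) := by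
    have hc : Continuous fun x : ℝ => |Real.log x * x| + x * Real.pi := by
      have := Real.continuous_mul_log
      simp_rw [mul_comm (Real.log _)]
      fun_prop
    simpa using hc.tendsto 0
  have h2 : Tendsto (fun z : ℂ => ‖z‖) (𝓝 0) (𝓝 0) := by
    simpa using (continuous_norm (E := ℂ)).tendsto 0
  refine squeeze_zero (fun _ => norm_nonneg _) (fun z => ?_) (h1.comp h2)
  rw [norm_mul]
  have h3 : ‖log z‖ ≤ |Real.log ‖z‖| + Real.pi := by
    refine (norm_le_abs_re_add_abs_im _).trans ?_
    rw [log_re, log_im]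
    gcongr
    exact abs_arg_le_pi z
  simp only [Function.comp_apply]
  calc _ ≤ ‖z‖ * (|Real.log ‖z‖| + Real.pi) := by gcongr
    _ = _ := by rw [abs_mul, abs_of_nonneg (norm_nonneg z)]; ring

/-- The quotient `(δ/2) / sin (δ/2)`, written through `expQuot`. -/
noncomputable def sinQuot (δ : ℂ) : ℂ := exp (-(I * δ / 2)) / expQuot (-(I * δ))

lemma hasDerivAt_expQuot_rot : HasDerivAt (fun δ => expQuot (-(I * δ))) (-(I / 2)) 0 := by
  have h1 : HasDerivAt (fun δ : ℂ => -(I * δ)) (-(I * 1)) 0 :=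
    ((hasDerivAt_id (0 : ℂ)).const_mul I).neg
  have h2 : HasDerivAt expQuot (1 / 2) (-(I * 0)) := by
    rw [mul_zero, neg_zero, ← deriv_expQuot_zero]
    exact (differentiable_expQuot 0).hasDerivAt
  refine (HasDerivAt.comp (0 : ℂ) h2 h1).congr_deriv ?_
  ring

lemma sinQuot_zero : sinQuot 0 = 1 := by simp [sinQuot, expQuot_zero]

/-- The vanishing derivative, due to evenness, gives `sinQuot δ - 1 = O(δ²)`, enough to beat the
factor `log δ / δ` in the main terms. -/
lemma hasDerivAt_sinQuot : HasDerivAt sinQuot 0 0 := by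
  have h1 : HasDerivAt (fun δ : ℂ => exp (-(I * δ / 2))) (exp (-(I * 0 / 2)) * -(I * 1 / 2)) 0 :=
    (((hasDerivAt_id (0 : ℂ)).const_mul I).div_const 2).neg.cexp
  have h := h1.div hasDerivAt_expQuot_rot (by simp [expQuot_zero])
  refine h.congr_deriv ?_
  simp [expQuot_zero]

lemma differentiableOn_sinQuot : DifferentiableOn ℂ sinQuot (Metric.ball 0 2) := by
  intro δ hδ
  refine DifferentiableAt.differentiableWithinAt (DifferentiableAt.div (by fun_prop)
    ((differentiable_expQuot _).comp δ (by fun_prop)) (expQuot_ne_zero (Or.inr ?_)))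
  rw [mem_ball_zero_iff] at hδ ⊢
  simpa using hδ

/-- The exact expression for `rotatedMean` in terms of the behaviour of the Lambert series at `0`. -/
lemma rotatedMean_sub_logLaplace {δ : ℂ} (h0 : 0 < δ.re) (h1 : δ.re < Real.pi)
    (hu : 0 < (expQuot (-(I * δ))).re) :
    rotatedMean δ - logLaplace δ =
      2 * Real.pi * exp (-(I * δ / 2)) * lambertRem (2 * Real.pi * δ * expQuot (-(I * δ)))
      + (Real.eulerMascheroniConstant - Real.log (2 * Real.pi) - log δ) * ((sinQuot δ - 1) / δ)
      - sinQuot δ * (log (expQuot (-(I * δ))) / δ)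
      - 2 * Real.pi * exp (-(I * δ / 2)) *
        ((Real.eulerMascheroniConstant - rotLog δ) / exp (rotLog δ)) := by
  have hδ0 : δ ≠ 0 := by rintro rfl; simp at h0
  have hu0 : expQuot (-(I * δ)) ≠ 0 := by intro h; simp [h] at hu
  have hpi : (Real.pi : ℂ) ≠ 0 := by exact_mod_cast Real.pi_ne_zero
  -- Periodicity moves the argument from near `2πi` to near `0`, using `2πi (exp(-iδ) - 1) = 2πδ ·
  -- expQuot(-iδ)`.
  have hper : lambert (exp (rotLog δ)) = lambert (2 * Real.pi * δ * expQuot (-(I * δ))) := by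
    rw [← lambert_add_two_pi_mul_I (2 * Real.pi * δ * expQuot (-(I * δ))), exp_rotLog,
      expQuot_of_ne (neg_ne_zero.mpr (mul_ne_zero I_ne_zero hδ0))]
    congr 1
    have hI := I_ne_zero
    field_simp
    linear_combination (exp (-(I * δ)) - 1) * I_sq
  have h2pi : (2 * Real.pi : ℂ) = ((2 * Real.pi : ℝ) : ℂ) := by push_cast; rfl
  have hlog : log (2 * Real.pi * δ * expQuot (-(I * δ))) =
      Real.log (2 * Real.pi) + log δ + log (expQuot (-(I * δ))) := by
    rw [log_mul_of_re_pos _ hu, h2pi, log_ofReal_mul (by positivity) hδ0]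
    rw [h2pi, re_ofReal_mul]
    have := Real.pi_pos
    positivity
  rw [rotatedMean, lambertRem, log_exp_rotLog h0 h1, hper, lambertRem, hlog, logLaplace, sinQuot]
  field_simp
  ring

/-- The four terms of `rotatedMean_sub_logLaplace` contribute `π/2`, `0`, `i/2` and `π/2 + i(γ - log
2π)`. -/
lemma tendsto_rotatedMean_sub_logLaplace {c : ℝ} (hc : 0 < c) (hc1 : c ≤ 1) :
    Tendsto (fun δ => rotatedMean δ - logLaplace δ) (𝓝[sector c] 0)
      (𝓝 (Real.pi + I * ((1 / 2 + Real.eulerMascheroniConstant - Real.log (2 * Real.pi) : ℝ) : ℂ)))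
      := by
  set l := 𝓝[sector c] (0 : ℂ)
  have hl0 : l ≤ 𝓝 0 := nhdsWithin_le_nhds
  have hl : l ≤ 𝓝[≠] 0 := nhdsWithin_mono _ fun z hz => hz.1
  have hmem : ∀ᶠ δ in l, δ ∈ sector c := self_mem_nhdsWithin
  have hpi := Real.pi_pos
  have hpi0 : (Real.pi : ℂ) ≠ 0 := by exact_mod_cast Real.pi_ne_zero
  have hu : Tendsto (fun δ => expQuot (-(I * δ))) (𝓝 0) (𝓝 1) := by
    have := hasDerivAt_expQuot_rot.continuousAt.tendsto
    simpa [expQuot_zero] using this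
  have hexp : Tendsto (fun δ : ℂ => 2 * Real.pi * exp (-(I * δ / 2))) (𝓝 0) (𝓝 (2 * Real.pi)) := by
    have := (by fun_prop : Continuous fun δ : ℂ => 2 * Real.pi * exp (-(I * δ / 2))).tendsto 0
    simpa using this
  have t1 : Tendsto (fun δ => lambertRem (2 * Real.pi * δ * expQuot (-(I * δ)))) l
      (𝓝 (1 / 4)) := by
    -- The factor `expQuot(-iδ)` turns the argument slightly, so the sector is widened from `c` to
    -- `c/2`.
    refine (tendsto_lambertRem (half_pos hc) (by linarith)).comp
      (tendsto_nhdsWithin_iff.mpr ⟨?_, ?_⟩)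
    · have h := (by fun_prop : Continuous fun δ : ℂ => 2 * Real.pi * δ).tendsto 0 |>.mul hu
      rw [mul_zero, zero_mul] at h
      exact h.mono_left hl0
    · have hball := hu.eventually (Metric.closedBall_mem_nhds (1 : ℂ) (by positivity : 0 < c / 4))
      filter_upwards [hmem, hl0 hball] with δ hδ hb
      refine mul_mem_sector_half hc hc1 ⟨mul_ne_zero (mul_ne_zero two_ne_zero hpi0) hδ.1, ?_⟩
        (mem_closedBall_iff_norm.mp hb)
      rw [show (2 * Real.pi * δ : ℂ) = ((2 * Real.pi : ℝ) : ℂ) * δ by push_cast; rfl,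
        re_ofReal_mul, norm_mul, norm_real, Real.norm_eq_abs, abs_of_pos (by positivity)]
      have := hδ.2
      nlinarith
  have t2 : Tendsto (fun δ => (Real.eulerMascheroniConstant - Real.log (2 * Real.pi) - log δ) *
      ((sinQuot δ - 1) / δ)) l (𝓝 0) := by
    have hd : DifferentiableAt ℂ (dslope sinQuot 0) 0 :=
      ((Complex.differentiableOn_dslope (Metric.ball_mem_nhds (0 : ℂ) two_pos)).mpr
        differentiableOn_sinQuot).differentiableAt (Metric.ball_mem_nhds _ two_pos)
    have hval : dslope sinQuot 0 0 = 0 := by rw [dslope_same, hasDerivAt_sinQuot.deriv]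
    have hO : dslope sinQuot 0 =O[𝓝 0] fun δ : ℂ => δ := by
      have := hd.isBigO_sub
      simp only [hval, sub_zero] at this
      exact this
    have hlim : Tendsto (fun δ : ℂ =>
        δ * (Real.eulerMascheroniConstant - Real.log (2 * Real.pi)) - δ * log δ) (𝓝 0) (𝓝 0) := by
      have h := ((by fun_prop : Continuous fun δ : ℂ =>
        δ * (Real.eulerMascheroniConstant - Real.log (2 * Real.pi) : ℂ)).tendsto 0).sub
        tendsto_mul_log
      rw [zero_mul, sub_zero] at h
      exact h
    have hO2 := (hO.mul (isBigO_refl (fun δ : ℂ =>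
      (Real.eulerMascheroniConstant - Real.log (2 * Real.pi) - log δ : ℂ)) (𝓝 0))).trans_tendsto
      (hlim.congr fun δ => by ring)
    refine (hO2.mono_left hl0).congr' ?_
    filter_upwards [hmem] with δ hδ
    rw [dslope_of_ne _ hδ.1, slope_def_field, sinQuot_zero, sub_zero]
    ring
  have t3 : Tendsto (fun δ => sinQuot δ * (log (expQuot (-(I * δ))) / δ)) l
      (𝓝 (1 * -(I / 2))) := by
    have hs : Tendsto sinQuot (𝓝 0) (𝓝 1) := by
      have := hasDerivAt_sinQuot.continuousAt.tendsto
      rwa [sinQuot_zero] at this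
    refine (hs.mono_left hl0).mul ?_
    have hd : HasDerivAt (fun δ => log (expQuot (-(I * δ)))) (-(I / 2)) 0 := by
      have := hasDerivAt_expQuot_rot.clog (by simp [expQuot_zero])
      simpa [expQuot_zero] using this
    refine ((hasDerivAt_iff_tendsto_slope_zero.mp hd).mono_left hl).congr fun δ => ?_
    simp [expQuot_zero, div_eq_inv_mul]
  have t4 : Tendsto (fun δ : ℂ => (Real.eulerMascheroniConstant - rotLog δ) / exp (rotLog δ)) (𝓝 0)
      (𝓝 ((Real.eulerMascheroniConstant - rotLog 0) / exp (rotLog 0))) := by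
    have hr : Continuous rotLog := by unfold rotLog; fun_prop
    exact ((continuous_const.sub hr).div hr.cexp fun δ => exp_ne_zero _).tendsto 0
  have h := ((((hexp.mono_left hl0).mul t1).add t2).sub t3).sub
    ((hexp.mono_left hl0).mul (t4.mono_left hl0))
  have hval : 2 * Real.pi * (1 / 4) + 0 - 1 * -(I / 2) -
      2 * Real.pi * ((Real.eulerMascheroniConstant - rotLog 0) / exp (rotLog 0)) =
      Real.pi + I * ((1 / 2 + Real.eulerMascheroniConstant - Real.log (2 * Real.pi) : ℝ) : ℂ) := by
    rw [exp_rotLog, rotLog, mul_zero, neg_zero, Complex.exp_zero]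
    have hI := I_ne_zero
    push_cast
    field_simp
    ring_nf
    simp only [I_sq]
    ring
  rw [hval] at h
  refine h.congr' ?_
  have hre : ∀ᶠ δ in l, 0 < (expQuot (-(I * δ))).re :=
    hl0 (((continuous_re.tendsto 1).comp hu).eventually_const_lt (by simp))
  have hsmall : ∀ᶠ δ : ℂ in l, δ.re < Real.pi :=
    hl0 ((continuous_re.tendsto 0).eventually_lt_const (by simpa using hpi))
  filter_upwards [hmem, hre, hsmall] with δ hδ h2 h3
  exact (rotatedMean_sub_logLaplace (re_pos_of_mem_sector hc hδ) h3 h2).symm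

lemma conj_logLaplace {δ : ℂ} (hδ : 0 < δ.re) : conj (logLaplace (conj δ)) = logLaplace δ := by
  have harg : arg δ ≠ Real.pi := by
    have := abs_lt.mp (abs_arg_lt_pi_div_two_iff.mpr (Or.inl hδ))
    linarith [Real.pi_pos]
  simp only [logLaplace, log_conj δ harg, map_div₀, map_sub, conj_ofReal, conj_conj]

lemma tendsto_integral_sub_integral {c : ℝ} (hc : 0 < c) (hc1 : c ≤ 1) :
    Tendsto (fun δ : ℂ => (∫ t in Ioi (0 : ℝ), zetaSq t * exp (-δ * t)) - logLaplace δ)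
      (𝓝[sector c] 0) (𝓝 Real.pi) := by
  have h1 := tendsto_rotatedMean_sub_logLaplace hc hc1
  have hconj : Tendsto (fun δ : ℂ => conj δ) (𝓝[sector c] 0) (𝓝[sector c] 0) := by
    refine tendsto_nhdsWithin_iff.mpr ⟨?_, ?_⟩
    · have := continuous_conj.tendsto (0 : ℂ)
      rw [map_zero] at this
      exact this.mono_left nhdsWithin_le_nhds
    · filter_upwards [self_mem_nhdsWithin] with δ hδ
      exact ⟨by simpa using hδ.1, by simpa using hδ.2⟩
  have h2 := (continuous_conj.tendsto _).comp (h1.comp hconj)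
  have h3 := ((h1.add h2).div_const 2).sub (tendsto_fermiCorrection.mono_left nhdsWithin_le_nhds)
  have hval : ((Real.pi + I * ((1 / 2 + Real.eulerMascheroniConstant -
      Real.log (2 * Real.pi) : ℝ) : ℂ)) + conj (Real.pi + I * ((1 / 2 +
      Real.eulerMascheroniConstant - Real.log (2 * Real.pi) : ℝ) : ℂ))) / 2 - 0 =
      (Real.pi : ℂ) := by
    rw [map_add, map_mul, conj_ofReal, conj_I, conj_ofReal]
    ring
  rw [hval] at h3
  refine h3.congr' ?_
  have hsmall : ∀ᶠ δ : ℂ in 𝓝[sector c] 0, δ.re < Real.pi :=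
    nhdsWithin_le_nhds ((continuous_re.tendsto 0).eventually_lt_const (by simpa using Real.pi_pos))
  filter_upwards [self_mem_nhdsWithin, hsmall] with δ hδ hs
  have hre := re_pos_of_mem_sector hc hδ
  have := symmetrized_rotatedMean hre hs
  simp only [Function.comp_apply, map_sub, conj_logLaplace hre]
  linear_combination this

/-- `Re δ = ‖δ‖ cos(arg δ)` and `cos(π/2 - η) = sin η`, so `c = sin η` works; for `η > π/2` the set
is empty. -/
lemma exists_sector_of_arg_le {η : ℝ} (hη : 0 < η) :
    ∃ c : ℝ, 0 < c ∧ c ≤ 1 ∧ {δ : ℂ | δ ≠ 0 ∧ |arg δ| ≤ Real.pi / 2 - η} ⊆ sector c := by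
  rcases le_or_gt η (Real.pi / 2) with h | h
  · refine ⟨Real.sin η, Real.sin_pos_of_pos_of_lt_pi hη (by linarith [Real.pi_pos]),
      Real.sin_le_one η, fun δ hδ => ⟨hδ.1, ?_⟩⟩
    rw [← norm_mul_cos_arg δ, mul_comm]
    gcongr
    rw [← Real.cos_pi_div_two_sub, ← Real.cos_abs (arg δ)]
    exact Real.cos_le_cos_of_nonneg_of_le_pi (abs_nonneg _) (by linarith [Real.pi_pos]) hδ.2
  · refine ⟨1, one_pos, le_rfl, fun δ hδ => ?_⟩
    have := (abs_nonneg (arg δ)).trans hδ.2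
    linarith

end ZetaMeanSquare

theorem mainTheorem8 :
    (∀ δ : ℂ, 0 < δ.re →
      MeasureTheory.IntegrableOn
        (fun t : ℝ => ((‖riemannZeta (1 / 2 + Complex.I * (t : ℂ))‖ ^ 2 : ℝ) : ℂ)
          * Complex.exp (-δ * (t : ℂ))) (Set.Ioi 0) MeasureTheory.volume) ∧
    (∀ δ : ℂ, 0 < δ.re →
      MeasureTheory.IntegrableOn
        (fun t : ℝ =>
          ((2 * Real.eulerMascheroniConstant + Real.log (t / (2 * Real.pi)) : ℝ) : ℂ)
            * Complex.exp (-δ * (t : ℂ))) (Set.Ioi 0) MeasureTheory.volume) ∧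
    (∀ η : ℝ, 0 < η →
      Filter.Tendsto
        (fun δ : ℂ =>
          (∫ t in Set.Ioi (0 : ℝ),
            ((‖riemannZeta (1 / 2 + Complex.I * (t : ℂ))‖ ^ 2 : ℝ) : ℂ)
              * Complex.exp (-δ * (t : ℂ)))
          - ∫ t in Set.Ioi (0 : ℝ),
            ((2 * Real.eulerMascheroniConstant + Real.log (t / (2 * Real.pi)) : ℝ) : ℂ)
              * Complex.exp (-δ * (t : ℂ)))
        (nhdsWithin 0 {δ : ℂ | δ ≠ 0 ∧ |Complex.arg δ| ≤ Real.pi / 2 - η})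
        (nhds (Real.pi : ℂ))) := by
  refine ⟨fun δ hδ => ZetaMeanSquare.integrableOn_zetaSq_mul_exp hδ,
    fun δ hδ => (ZetaMeanSquare.integral_log_mul_exp hδ).1, fun η hη => ?_⟩
  obtain ⟨c, hc, hc1, hsub⟩ := ZetaMeanSquare.exists_sector_of_arg_le hη
  refine ((ZetaMeanSquare.tendsto_integral_sub_integral hc hc1).mono_left
    (nhdsWithin_mono _ hsub)).congr' ?_
  filter_upwards [self_mem_nhdsWithin] with δ hδ
  rw [(ZetaMeanSquare.integral_log_mul_exp
    (ZetaMeanSquare.re_pos_of_mem_sector hc (hsub hδ))).2]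
  rfl
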